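/- Let $k$ be an algebraically closed field of characteristic $0$, let $A$ be an abelian group with neutral element $e$, and let $\mathcal C=\bigoplus_{a\in A}\mathcal C_a$ be an $A$-graded ribbon fusion category over $k$, with braiding $c$ and twist $\theta$. *Zesting data.* An $A$-ribbon zesting of $\mathcal C$ (with trivial $j$) is a triple $(\lambda,t,f)$ consisting of a normalized 2-cocycle $\lambda$ on $A$ with values in the invertible objects of $\mathcal C_e$, together with normalized isomorphisms $$\lambda_{a,b,c}\colon\lambda(a,b)\otimes\lambda(ab,c)\to\lambda(b,c)\otimes\lambda(a,bc);$$ isomorphisms $t(a,b)\colon\lambda(a,b)\to\lambda(b,a)$; and a function $f\colon A\to k^\times$. Suppressing the associators of $\mathcal C$, and composing from right to left, they satisfy, for all $a,b,c,d\in A$: 1. $(\lambda_{b,c,d}\otimes\mathrm{id})(\mathrm{id}\otimes\lambda_{a,bc,d})(\lambda_{a,b,c}\otimes\mathrm{id})=(\mathrm{id}\otimes\lambda_{a,b,cd})\,(c^{-1}_{\lambda(c,d),\lambda(a,b)}\otimes\mathrm{id})(\mathrm{id}\otimes\lambda_{ab,c,d})$; 2. $\lambda_{b,c,a}\,(\mathrm{id}_{\lambda(b,c)}\otimes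 t(a,bc))\,\lambda_{a,b,c}=(t(a,c)\otimes\mathrm{id})\,\lambda_{b,a,c}\,(t(a,b)\otimes\mathrm{id})$; 3. $\chi_{\lambda(a,b)}(c)\;\lambda_{c,a,b}^{-1}\,(\mathrm{id}_{\lambda(a,b)}\otimes t(ab,c))\,\lambda_{a,b,c}^{-1}=(t(a,c)\otimes\mathrm{id})\,\lambda_{a,c,b}^{-1}\,(t(b,c)\otimes\mathrm{id})$; 4. $f(ab)\,\chi_{\lambda(a,b)}(ab)\,\theta_{\lambda(a,b)}=f(a)f(b)\;t(b,a)\,t(a,b)$; 5. $f(a)\,\mathrm{id}=f(a^{-1})\,\chi_{\lambda(a,a^{-1})}(a)\,\theta_{\lambda(a,a^{-1})}$. Here, for those $p=\lambda(a,b)$ and $g\in A$ that occur, it is part of the data being a zesting that the double braiding $c_{p,X}\circ c_{X,p}$ is the same scalar, denoted $\chi_p(g)$, for all $X\in\mathcal C_g$. *Zested category.* The ribbon category $\mathcal C^{\lambda,t,f}$ has the same objects and morphisms as $\mathcal C$. For homogeneous objects $X\in\mathcal C_a$, $Y\in\mathcal C_b$, $Z\in\mathcal C_c$, its tensor product is $X\otimes^\lambda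 Y=(X\otimes Y)\otimes\lambda(a,b)$; its associator is the composite of $c_{Z,\lambda(a,b)}^{-1}\colon\lambda(a,b)\otimes Z\to Z\otimes\lambda(a,b)$ with $\lambda_{a,b,c}$; its braiding is $c_{X,Y}\otimes t(a,b)$; and its twist is $f(a)\,\theta_X$. *Link invariants.* Let a framed oriented link be presented, with its blackboard framing, as the Markov closure of a braid word $b$. In a ribbon category, color each component of the link by an object. Then $b$ becomes an endomorphism of the tensor product of the colors of the strands, a positive crossing acting by the braiding and a negative one by the inverse braiding. The Reshetikhin–Turaev invariant of the colored link is the categorical (ribbon) trace of this endomorphism. **Theorem.** Let $L$ be a framed link with $n$ components. For every $A$-ribbon zesting $(\lambda,t,f)$ of $\mathcal C$ and all $i_1,\dots,i_n\in A$ there is a nonzero scalar $h(\lambda,t,f,i_1,\dots,i_n)\in k^\times$ such that, for all simple objects $X_1\in\mathcal C_{i_1},\dots,X_n\in\mathcal C_{i_n}$, $$L^{\lambda,t,f}_{X_1,\dots,X_n}=h(\lambda,t,f,i_1,\dots,i_n)\cdot L_{X_1,\dots,X_n},$$ where $L_{X_1,\dots,X_n}$ and $L^{\lambda,t,f}_{X_1,\dots,X_n}$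 are the Reshetikhin–Turaev invariants of $L$, with its $j$-th component colored by $X_j$, computed in $\mathcal C$ and in $\mathcal C^{\lambda,t,f}$. In particular, for a given link the scalar depends only on the zesting data and the grades, not on the chosen simple objects. -/

import Mathlib

set_option linter.unusedSectionVars false
set_option linter.unusedVariables false

open CategoryTheory MonoidalCategory Limits

universe v u

namespace Zesting

/-! ### Ribbon fusion categories -/

/-- A ribbon structure on a rigid braided monoidal category: a natural automorphism `θ` of the
identity functor with `θ_{X ⊗ Y} = c_{Y,X} ∘ c_{X,Y} ∘ (θ_X ⊗ θ_Y)` and `(θ_X)^* = θ_{X^*}`. -/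
class RibbonCategory (C : Type u) [Category.{v} C] [MonoidalCategory C] [BraidedCategory C]
    [RightRigidCategory C] where
  /-- the twist `θ_X` -/
  twist (X : C) : X ≅ X
  twist_naturality {X Y : C} (f : X ⟶ Y) : f ≫ (twist Y).hom = (twist X).hom ≫ f
  twist_tensor (X Y : C) : (twist (X ⊗ Y)).hom =
    ((twist X).hom ⊗ₘ (twist Y).hom) ≫ (β_ X Y).hom ≫ (β_ Y X).hom
  twist_dual (X : C) : ((twist X).hom)ᘁ = (twist (Xᘁ)).hom

attribute [local instance] Abelian.hasFiniteBiproducts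

/-- Fusion: finite-dimensional hom spaces, simple tensor unit, every object a finite direct sum of
simple objects, finitely many isomorphism classes of simple objects. (Rigidity and bilinearity of
the tensor product are separate instance arguments.) -/
class IsFusionCategory (k : Type*) [Field k] (C : Type u) [Category.{v} C] [Abelian C] [Linear k C]
    [MonoidalCategory C] : Prop where
  finite_hom (X Y : C) : Module.Finite k (X ⟶ Y)
  simple_unit : Simple (𝟙_ C)
  semisimple (X : C) : ∃ (n : ℕ) (S : Fin n → C), (∀ i, Simple (S i)) ∧ Nonempty (X ≅ ⨁ S)
  finite_simples : ∃ (n : ℕ) (S : Fin n → C), ∀ X : C, Simple X → ∃ i, Nonempty (X ≅ S i)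

/-! ### Framed links as Markov closures of braids, and their invariants -/

/-- One crossing in a braid diagram read from top to bottom. Each strand carries a label in `ι`;
the lists are the labels of the strands above and below the crossing, from left to right.
`cons` adds a vertical strand on the left. -/
inductive Crossing (ι : Type) : List ι → List ι → Type
  | pos (i j : ι) (l : List ι) : Crossing ι (i :: j :: l) (j :: i :: l)
  | neg (i j : ι) (l : List ι) : Crossing ι (i :: j :: l) (j :: i :: l)
  | cons (i : ι) {l l' : List ι} (c : Crossing ι l l') : Crossing ι (i :: l) (i :: l')

/-- A braid word with labelled strands: a finite sequence of crossings. -/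
inductive BraidWord (ι : Type) : List ι → List ι → Type
  | nil (l : List ι) : BraidWord ι l l
  | cons {l l' l'' : List ι} (c : Crossing ι l l') (b : BraidWord ι l' l'') : BraidWord ι l l''

/-- How a crossing moves the positions of the strands. -/
def Crossing.perm {ι : Type} : {l l' : List ι} → Crossing ι l l' → (Fin l.length ≃ Fin l'.length)
  | _, _, .pos _ _ l => Equiv.swap (0 : Fin (l.length + 2)) 1
  | _, _, .neg _ _ l => Equiv.swap (0 : Fin (l.length + 2)) 1
  | _, _, .cons _ (l := l) (l' := l') c =>
      (finSuccEquiv l.length).trans (c.perm.optionCongr.trans (finSuccEquiv l'.length).symm)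

/-- How a braid word moves the positions of the strands. -/
def BraidWord.perm {ι : Type} :
    {l l' : List ι} → BraidWord ι l l' → (Fin l.length ≃ Fin l'.length)
  | _, _, .nil l => Equiv.refl _
  | _, _, .cons c b => c.perm.trans b.perm

/-- A framed link with `n` numbered components, presented as the Markov closure of a braid with
the blackboard framing (every framed oriented link has such a presentation). Every strand is
labelled by the component of the closure to which it belongs: every component occurs, and two
strands with the same label lie in the same cycle of the permutation of the braid. (That a label
is constant along a cycle is built into `BraidWord`.) -/
structure FramedLink (n : ℕ) where
  /-- the component of each strand, from left to right -/
  strands : List (Fin n)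
  /-- the braid -/
  braid : BraidWord (Fin n) strands strands
  mem_strands (j : Fin n) : j ∈ strands
  sameCycle (a b : Fin strands.length) (h : strands.get a = strands.get b) :
    Equiv.Perm.SameCycle (show Equiv.Perm (Fin strands.length) from braid.perm) a b

section Invariant

variable {C : Type u} [Category.{v} C] [MonoidalCategory C]

/-- The tensor product `X_{i₁} ⊗ (X_{i₂} ⊗ ⋯)` of the colours of a row of strands. -/
def strandsObj {ι : Type} (X : ι → C) : List ι → C
  | [] => 𝟙_ C
  | i :: l => X i ⊗ strandsObj X l

variable [BraidedCategory C]

/-- The morphism of a crossing: a braiding `c_{X,Y}` for a positive crossing, the inverse braiding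
`c_{Y,X}⁻¹` for a negative one, tensored with identities. -/
def Crossing.eval {ι : Type} (X : ι → C) :
    {l l' : List ι} → Crossing ι l l' → (strandsObj X l ⟶ strandsObj X l')
  | _, _, .pos i j l => (α_ (X i) (X j) (strandsObj X l)).inv ≫ (β_ (X i) (X j)).hom ▷ strandsObj X l ≫
      (α_ (X j) (X i) (strandsObj X l)).hom
  | _, _, .neg i j l => (α_ (X i) (X j) (strandsObj X l)).inv ≫ (β_ (X j) (X i)).inv ▷ strandsObj X l ≫
      (α_ (X j) (X i) (strandsObj X l)).hom
  | _, _, .cons i c => X i ◁ c.eval X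

/-- The morphism of a braid word. -/
def BraidWord.eval {ι : Type} (X : ι → C) :
    {l l' : List ι} → BraidWord ι l l' → (strandsObj X l ⟶ strandsObj X l')
  | _, _, .nil l => 𝟙 (strandsObj X l)
  | _, _, .cons c b => c.eval X ≫ b.eval X

variable [RightRigidCategory C] [RibbonCategory C]

/-- The categorical trace `ev ∘ c_{X,X^*} ∘ ((θ_X ∘ f) ⊗ id) ∘ coev` of an endomorphism in a
ribbon category. -/
def trace {X : C} (f : X ⟶ X) : 𝟙_ C ⟶ 𝟙_ C :=
  η_ X Xᘁ ≫ (f ≫ (RibbonCategory.twist X).hom) ▷ Xᘁ ≫ (β_ X Xᘁ).hom ≫ ε_ X Xᘁ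

/-- The Reshetikhin–Turaev invariant, in `End(𝟙)`, of a framed link whose `j`-th component is
coloured by `X j`: the trace of the morphism of the braid. -/
def FramedLink.invariant {n : ℕ} (L : FramedLink n) (X : Fin n → C) : 𝟙_ C ⟶ 𝟙_ C :=
  trace (L.braid.eval X)

end Invariant

/-! ### Gradings and zesting data -/

section Data

variable {C : Type u} [Category.{v} C] [Abelian C] [MonoidalCategory C]

/-- A grading `C = ⨁ₐ C_a` of a monoidal category by an abelian group `A`, by full
(isomorphism-closed, additive) subcategories `C_a` with `C_a ⊗ C_b ⊆ C_{ab}`. -/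
structure Grading (A : Type*) [CommGroup A] (C : Type u) [Category.{v} C] [Abelian C]
    [MonoidalCategory C] where
  /-- the component `C_a` -/
  comp : A → ObjectProperty C
  of_iso {a : A} {X Y : C} (e : X ≅ Y) : comp a X → comp a Y
  biproduct_mem {a : A} {n : ℕ} (Y : Fin n → C) : (∀ i, comp a (Y i)) → comp a (⨁ Y)
  decomposition (X : C) : ∃ (n : ℕ) (g : Fin n → A) (Y : Fin n → C),
    (∀ i, comp (g i) (Y i)) ∧ Nonempty (X ≅ ⨁ Y)
  hom_eq_zero {a b : A} {X Y : C} (hX : comp a X) (hY : comp b Y) (hab : a ≠ b) (f : X ⟶ Y) : f = 0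
  unit_mem : comp 1 (𝟙_ C)
  tensor_mem {a b : A} {X Y : C} : comp a X → comp b Y → comp (a * b) (X ⊗ Y)

variable {A : Type*} [CommGroup A]

/-- The identity `λ(a,b) = λ(a',b')` when `a = a'` and `b = b'`. -/
def lamCast (lam : A → A → C) {a a' b b' : A} (ha : a = a') (hb : b = b') : lam a b ≅ lam a' b' :=
  eqToIso (by rw [ha, hb])

variable [BraidedCategory C]

/-- An associative zesting: a normalised 2-cocycle `λ` with values in the invertible objects of
`C_e` together with normalised isomorphisms
`λ_{a,b,c} : λ(a,b) ⊗ λ(ab,c) ⟶ λ(b,c) ⊗ λ(a,bc)` subject to the associative zesting condition.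
The normalisation `λ(e,a) = 𝟙 = λ(a,e)` is given by chosen isomorphisms. -/
structure AssociativeZesting (G : Grading A C) where
  lam : A → A → C
  lam_mem (a b : A) : G.comp 1 (lam a b)
  lam_invertible (a b : A) : ∃ M : C, G.comp 1 M ∧ Nonempty (lam a b ⊗ M ≅ 𝟙_ C)
  unitL (a : A) : lam 1 a ≅ 𝟙_ C
  unitR (a : A) : lam a 1 ≅ 𝟙_ C
  assoc (a b c : A) : lam a b ⊗ lam (a * b) c ≅ lam b c ⊗ lam a (b * c)
  normalized (a b : A) :
    (assoc a 1 b).hom ≫ ((unitL b).hom ⊗ₘ (lamCast lam rfl (one_mul b)).hom) ≫ (λ_ (lam a b)).hom =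
      ((unitR a).hom ⊗ₘ (lamCast lam (mul_one a) rfl).hom) ≫ (λ_ (lam a b)).hom
  associative_condition (a b c d : A) :
    ((assoc a b c).hom ⊗ₘ (lamCast lam (mul_assoc a b c) (rfl : d = d)).hom) ≫ (α_ _ _ _).hom ≫
        lam b c ◁ (assoc a (b * c) d).hom ≫ (α_ _ _ _).inv ≫
        ((assoc b c d).hom ⊗ₘ (lamCast lam rfl (mul_assoc b c d)).hom) ≫ (α_ _ _ _).hom =
      (α_ _ _ _).hom ≫ lam a b ◁ (assoc (a * b) c d).hom ≫ (α_ _ _ _).inv ≫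
        (β_ (lam c d) (lam a b)).inv ▷ lam (a * b) (c * d) ≫ (α_ _ _ _).hom ≫
        lam c d ◁ (assoc a b (c * d)).hom

/-- The double braiding of the object `p` with every object of `C_c` is the scalar `s`; that is,
`χ_p(c) = s`. -/
def Grading.HasMonodromy {k : Type*} [Field k] [Linear k C] (G : Grading A C) (p : C) (c : A)
    (s : k) : Prop :=
  ∀ X : C, G.comp c X → (β_ X p).hom ≫ (β_ p X).hom = s • 𝟙 (X ⊗ p)

/-- A braided zesting with trivial `j`: isomorphisms `t(a,b) : λ(a,b) ⟶ λ(b,a)` subject to the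
two braided zesting conditions, the second with the scalar
`ω(a,b;c) = χ_{λ(a,b)}(c)`. -/
structure BraidedZesting (k : Type*) [Field k] [Linear k C] (G : Grading A C) extends
    AssociativeZesting G where
  t (a b : A) : lam a b ≅ lam b a
  braided_condition₁ (a b c : A) :
    (assoc a b c).hom ≫ lam b c ◁ (t a (b * c)).hom ≫ (assoc b c a).hom =
      ((t a b).hom ⊗ₘ (lamCast lam (mul_comm a b) rfl).hom) ≫ (assoc b a c).hom ≫
        ((t a c).hom ⊗ₘ (lamCast lam rfl (mul_comm a c)).hom)
  braided_condition₂ (a b c : A) : ∃ ω : k, G.HasMonodromy (lam a b) c ω ∧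
    ω • ((assoc a b c).inv ≫ lam a b ◁ (t (a * b) c).hom ≫ (assoc c a b).inv) =
      ((t b c).hom ⊗ₘ (lamCast lam rfl (mul_comm b c)).hom) ≫ (assoc a c b).inv ≫
        ((t a c).hom ⊗ₘ (lamCast lam (mul_comm a c) rfl).hom)

variable [RightRigidCategory C] [RibbonCategory C]

/-- An `A`-ribbon zesting `(λ, t, f)` with trivial `j`. -/
structure RibbonZesting (k : Type*) [Field k] [Linear k C] (G : Grading A C) extends
    BraidedZesting k G where
  f : A → kˣ
  twist_condition (a b : A) : ∃ χ : k, G.HasMonodromy (lam a b) (a * b) χ ∧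
    ((f (a * b) : k) * χ) • (RibbonCategory.twist (lam a b)).hom =
      ((f a : k) * f b) • ((t a b).hom ≫ (t b a).hom)
  ribbon_condition (a : A) : ∃ χ : k, G.HasMonodromy (lam a a⁻¹) a χ ∧
    (f a : k) • 𝟙 (lam a a⁻¹) =
      ((f a⁻¹ : k) * χ) • (RibbonCategory.twist (lam a a⁻¹)).hom

/-- The objects of the zested category `C^{λ,t,f}`: homogeneous objects of `C`. (Simple objects
are homogeneous, and tensor products of homogeneous objects are homogeneous; the whole zested
category consists of direct sums of these.) Morphisms, tensor product, braiding, duals and twist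
are defined below. -/
structure Zested {k : Type*} [Field k] [Linear k C] {G : Grading A C}
    (Z : RibbonZesting k G) where
  grade : A
  obj : C
  mem : G.comp grade obj

end Data

/-! ### Building blocks of the zested category -/

section Raw

variable {C : Type u} [Category.{v} C] [MonoidalCategory C] [BraidedCategory C]

/-- The zested associator for an isomorphism `l : p ⊗ q ≅ s ⊗ u` of invertible objects: the strand
`p` passes under `Z`, then `l` is applied. -/
def asc (X Y Z : C) {p q s u : C} (l : p ⊗ q ≅ s ⊗ u) :
    (((X ⊗ Y) ⊗ p) ⊗ Z) ⊗ q ≅ (X ⊗ ((Y ⊗ Z) ⊗ s)) ⊗ u :=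
  whiskerRightIso (α_ (X ⊗ Y) p Z ≪≫ whiskerLeftIso (X ⊗ Y) (β_ Z p).symm) q ≪⊗≫
    whiskerLeftIso ((X ⊗ Y) ⊗ Z) l ≪⊗≫ Iso.refl _

lemma asc_hom (X Y Z : C) {p q s u : C} (l : p ⊗ q ≅ s ⊗ u) :
    (asc X Y Z l).hom = 𝟙 _ ⊗≫ (X ⊗ Y) ◁ (β_ Z p).inv ▷ q ⊗≫ ((X ⊗ Y) ⊗ Z) ◁ l.hom ⊗≫ 𝟙 _ := by
  simp only [asc, monoidalIsoComp, Iso.trans_hom, whiskerRightIso_hom, whiskerLeftIso_hom, Iso.symm_hom, Iso.refl_hom]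
  monoidal

lemma asc_inv (X Y Z : C) {p q s u : C} (l : p ⊗ q ≅ s ⊗ u) :
    (asc X Y Z l).inv = 𝟙 _ ⊗≫ ((X ⊗ Y) ⊗ Z) ◁ l.inv ⊗≫ (X ⊗ Y) ◁ (β_ Z p).hom ▷ q ⊗≫ 𝟙 _ := by
  simp only [asc, monoidalIsoComp, Iso.trans_inv, whiskerRightIso_inv, whiskerLeftIso_inv, Iso.symm_inv, Iso.refl_inv]
  monoidal

lemma pentCore (Z W : C) {p q r r' s u w x x' y z m : C}
    (l1 : p ⊗ q ⟶ s ⊗ u) (ρ : r ⟶ r') (l2 : u ⊗ r' ⟶ w ⊗ x) (l3 : s ⊗ w ⟶ y ⊗ z) (σ : x ⟶ x')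
    (l4 : q ⊗ r ⟶ y ⊗ m) (l5 : p ⊗ m ⟶ z ⊗ x')
    (h : (l1 ⊗ₘ ρ) ≫ (α_ _ _ _).hom ≫ s ◁ l2 ≫ (α_ _ _ _).inv ≫ (l3 ⊗ₘ σ) ≫ (α_ _ _ _).hom
      = (α_ _ _ _).hom ≫ p ◁ l4 ≫ (α_ _ _ _).inv ≫ (β_ y p).inv ▷ m ≫ (α_ _ _ _).hom ≫ y ◁ l5) :
    (β_ Z p).inv ▷ (q ⊗ W ⊗ r) ⊗≫ Z ◁ l1 ▷ (W ⊗ r) ⊗≫ (Z ⊗ s ⊗ u ⊗ W) ◁ ρ ⊗≫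
      Z ◁ s ◁ (β_ W u).inv ▷ r' ⊗≫ (Z ⊗ s ⊗ W) ◁ l2 ⊗≫ Z ◁ (β_ W s).inv ▷ (w ⊗ x) ⊗≫
      (Z ⊗ W) ◁ l3 ▷ x ⊗≫ (Z ⊗ W ⊗ y ⊗ z) ◁ σ =
    𝟙 _ ⊗≫ (p ⊗ Z) ◁ (β_ W q).inv ▷ r ⊗≫ (p ⊗ Z ⊗ W) ◁ l4 ⊗≫ (β_ ((Z ⊗ W) ⊗ y) p).inv ▷ m ⊗≫
      (Z ⊗ W ⊗ y) ◁ l5 ⊗≫ 𝟙 _ := by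
  calc
    _ = 𝟙 _ ⊗≫ (β_ Z p).inv ▷ (q ⊗ W ⊗ r) ⊗≫ Z ◁ l1 ▷ (W ⊗ r) ⊗≫
      Z ◁ s ◁ ((u ⊗ W) ◁ ρ ≫ (β_ W u).inv ▷ r') ⊗≫ Z ◁ ((s ⊗ W) ◁ l2 ≫ (β_ W s).inv ▷ (w ⊗ x)) ⊗≫
      (Z ⊗ W) ◁ l3 ▷ x ⊗≫ (Z ⊗ W ⊗ y ⊗ z) ◁ σ := by monoidal
    _ = 𝟙 _ ⊗≫ (β_ Z p).inv ▷ (q ⊗ W ⊗ r) ⊗≫ Z ◁ (l1 ▷ W ≫ (β_ W (s ⊗ u)).inv) ▷ r ⊗≫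
      (Z ⊗ W) ◁ ((s ⊗ u) ◁ ρ ⊗≫ s ◁ l2 ⊗≫ l3 ▷ x ⊗≫ (y ⊗ z) ◁ σ) ⊗≫ 𝟙 _ := by
      rw [whisker_exchange, whisker_exchange]
      calc
        _ = 𝟙 _ ⊗≫ (β_ Z p).inv ▷ (q ⊗ W ⊗ r) ⊗≫ Z ◁ l1 ▷ (W ⊗ r) ⊗≫
          Z ◁ s ◁ (β_ W u).inv ▷ r ⊗≫ Z ◁ ((s ⊗ W) ◁ (u ◁ ρ) ≫ (β_ W s).inv ▷ (u ⊗ r')) ⊗≫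
          Z ◁ (W ⊗ s) ◁ l2 ⊗≫ (Z ⊗ W) ◁ l3 ▷ x ⊗≫ (Z ⊗ W ⊗ y ⊗ z) ◁ σ ⊗≫ 𝟙 _ := by monoidal
        _ = _ := by
          rw [whisker_exchange, BraidedCategory.braiding_tensor_right_inv]
          monoidal
    _ = 𝟙 _ ⊗≫ (β_ Z p).inv ▷ (q ⊗ W ⊗ r) ⊗≫ Z ◁ (β_ W (p ⊗ q)).inv ▷ r ⊗≫
      (Z ⊗ W) ◁ ((l1 ⊗ₘ ρ) ≫ (α_ _ _ _).hom ≫ s ◁ l2 ≫ (α_ _ _ _).inv ≫ (l3 ⊗ₘ σ) ≫ (α_ _ _ _).hom) ⊗≫ 𝟙 _ := by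
      rw [BraidedCategory.braiding_inv_naturality_left, MonoidalCategory.tensorHom_def, MonoidalCategory.tensorHom_def]
      monoidal
    _ = 𝟙 _ ⊗≫ ((β_ Z p).inv ▷ (q ⊗ W) ≫ (Z ⊗ p) ◁ (β_ W q).inv) ▷ r ⊗≫ Z ◁ ((β_ W p).inv ▷ (q ⊗ r) ≫ (W ⊗ p) ◁ l4) ⊗≫
      (Z ⊗ W) ◁ (β_ y p).inv ▷ m ⊗≫ (Z ⊗ W ⊗ y) ◁ l5 ⊗≫ 𝟙 _ := by
      rw [h, BraidedCategory.braiding_tensor_right_inv]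
      monoidal
    _ = 𝟙 _ ⊗≫ (p ⊗ Z) ◁ (β_ W q).inv ▷ r ⊗≫ ((β_ Z p).inv ▷ (W ⊗ q ⊗ r) ≫ (Z ⊗ p) ◁ (W ◁ l4)) ⊗≫ Z ◁ (β_ W p).inv ▷ (y ⊗ m) ⊗≫
      (Z ⊗ W) ◁ (β_ y p).inv ▷ m ⊗≫ (Z ⊗ W ⊗ y) ◁ l5 ⊗≫ 𝟙 _ := by
      rw [← whisker_exchange, ← whisker_exchange]
      monoidal
    _ = _ := by
      rw [← whisker_exchange]
      simp only [BraidedCategory.braiding_tensor_left_inv]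
      monoidal

lemma pent (X Y Z W : C) {p q r r' s u w x x' y z m : C}
    (l1 : p ⊗ q ≅ s ⊗ u) (ρ : r ⟶ r') (l2 : u ⊗ r' ≅ w ⊗ x) (l3 : s ⊗ w ≅ y ⊗ z) (σ : x ⟶ x')
    (l4 : q ⊗ r ≅ y ⊗ m) (l5 : p ⊗ m ≅ z ⊗ x')
    (h : (l1.hom ⊗ₘ ρ) ≫ (α_ _ _ _).hom ≫ s ◁ l2.hom ≫ (α_ _ _ _).inv ≫ (l3.hom ⊗ₘ σ) ≫ (α_ _ _ _).hom
      = (α_ _ _ _).hom ≫ p ◁ l4.hom ≫ (α_ _ _ _).inv ≫ (β_ y p).inv ▷ m ≫ (α_ _ _ _).hom ≫ y ◁ l5.hom) :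
    (((asc X Y Z l1).hom ▷ W) ⊗ₘ ρ) ≫ (asc X ((Y ⊗ Z) ⊗ s) W l2).hom ≫ ((X ◁ (asc Y Z W l3).hom) ⊗ₘ σ)
      = (asc ((X ⊗ Y) ⊗ p) Z W l4).hom ≫ (asc X Y ((Z ⊗ W) ⊗ y) l5).hom := by
  simp only [asc_hom]
  have := pentCore Z W l1.hom ρ l2.hom l3.hom σ l4.hom l5.hom h
  calc
    _ = 𝟙 _ ⊗≫ (X ⊗ Y) ◁ ((β_ Z p).inv ▷ (q ⊗ W ⊗ r) ⊗≫ Z ◁ l1.hom ▷ (W ⊗ r) ⊗≫ (Z ⊗ s ⊗ u ⊗ W) ◁ ρ ⊗≫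
      Z ◁ s ◁ (β_ W u).inv ▷ r' ⊗≫ (Z ⊗ s ⊗ W) ◁ l2.hom ⊗≫ Z ◁ (β_ W s).inv ▷ (w ⊗ x) ⊗≫
      (Z ⊗ W) ◁ l3.hom ▷ x ⊗≫ (Z ⊗ W ⊗ y ⊗ z) ◁ σ) ⊗≫ 𝟙 _ := by
        rw [MonoidalCategory.tensorHom_def, MonoidalCategory.tensorHom_def]
        monoidal
    _ = _ := by rw [this]; monoidal

lemma asc_nat {X X' Y Y' Z Z' : C} (f : X ⟶ X') (g : Y ⟶ Y') (h : Z ⟶ Z') {p q s u : C} (l : p ⊗ q ≅ s ⊗ u) :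
    (((((f ⊗ₘ g) ⊗ₘ 𝟙 p) ⊗ₘ h) ⊗ₘ 𝟙 q)) ≫ (asc X' Y' Z' l).hom =
      (asc X Y Z l).hom ≫ ((f ⊗ₘ ((g ⊗ₘ h) ⊗ₘ 𝟙 s)) ⊗ₘ 𝟙 u) := by
  simp only [asc_hom, MonoidalCategory.tensorHom_def]
  calc
    _ = 𝟙 _ ⊗≫ f ▷ (Y ⊗ p ⊗ Z ⊗ q) ⊗≫ X' ◁ g ▷ (p ⊗ Z ⊗ q) ⊗≫
        (X' ⊗ Y') ◁ (p ◁ h ≫ (β_ Z' p).inv) ▷ q ⊗≫ (X' ⊗ Y' ⊗ Z') ◁ l.hom ⊗≫ 𝟙 _ := by monoidal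
    _ = 𝟙 _ ⊗≫ f ▷ (Y ⊗ p ⊗ Z ⊗ q) ⊗≫ X' ◁ (g ▷ (p ⊗ Z) ≫ Y' ◁ (β_ Z p).inv) ▷ q ⊗≫
        (X' ⊗ Y') ◁ (h ▷ (p ⊗ q) ≫ Z' ◁ l.hom) ⊗≫ 𝟙 _ := by
      rw [BraidedCategory.braiding_inv_naturality_right]; monoidal
    _ = 𝟙 _ ⊗≫ (f ▷ (Y ⊗ p ⊗ Z) ≫ X' ◁ (Y ◁ (β_ Z p).inv)) ▷ q ⊗≫ X' ◁ (g ▷ (Z ⊗ p ⊗ q) ≫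
        Y' ◁ (Z ◁ l.hom)) ⊗≫ (X' ⊗ Y') ◁ h ▷ (s ⊗ u) ⊗≫ 𝟙 _ := by
      rw [← whisker_exchange, ← whisker_exchange]; monoidal
    _ = 𝟙 _ ⊗≫ (X ⊗ Y) ◁ (β_ Z p).inv ▷ q ⊗≫ (f ▷ (Y ⊗ Z ⊗ p ⊗ q) ≫ X' ◁ (Y ◁ (Z ◁ l.hom))) ⊗≫
        X' ◁ g ▷ (Z ⊗ s ⊗ u) ⊗≫ (X' ⊗ Y') ◁ h ▷ (s ⊗ u) ⊗≫ 𝟙 _ := by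
      rw [← whisker_exchange, ← whisker_exchange]; monoidal
    _ = _ := by
      rw [← whisker_exchange]; monoidal

lemma tri (X Y : C) {p q s u z : C} (l : p ⊗ q ≅ s ⊗ u) (r : p ≅ 𝟙_ C) (m : s ≅ 𝟙_ C)
    (σ : u ⟶ z) (ρ : q ⟶ z)
    (h : l.hom ≫ (m.hom ⊗ₘ σ) ≫ (λ_ z).hom = (r.hom ⊗ₘ ρ) ≫ (λ_ z).hom) :
    (asc X (𝟙_ C) Y l).hom ≫ ((X ◁ (((λ_ Y).hom ⊗ₘ m.hom) ≫ (ρ_ Y).hom)) ⊗ₘ σ) =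
      ((((ρ_ X).hom ⊗ₘ r.hom) ≫ (ρ_ X).hom) ▷ Y) ⊗ₘ ρ := by
  simp only [asc_hom, MonoidalCategory.tensorHom_def] at h ⊢
  have hb : (β_ Y (𝟙_ C)).inv = (λ_ Y).hom ≫ (ρ_ Y).inv := by
    rw [braiding_inv_tensorUnit_right]
  calc
    _ = 𝟙 _ ⊗≫ X ◁ (β_ Y p).inv ▷ q ⊗≫ (X ⊗ Y) ◁ (l.hom ≫ (m.hom ▷ u ≫ 𝟙_ C ◁ σ) ≫ (λ_ z).hom) ⊗≫ 𝟙 _ := by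
      monoidal
    _ = 𝟙 _ ⊗≫ X ◁ ((β_ Y p).inv ≫ Y ◁ r.hom) ▷ q ⊗≫ (X ⊗ Y) ◁ ρ ⊗≫ 𝟙 _ := by
      rw [h]; monoidal
    _ = _ := by
      rw [← BraidedCategory.braiding_inv_naturality_left, hb]
      monoidal

lemma hexF (X Y Z : C) {p q s u u' v w p' q' v' w' : C}
    (l1 : p ⊗ q ≅ s ⊗ u) (t : u ⟶ u') (l2 : s ⊗ u' ≅ v ⊗ w)
    (t1 : p ⟶ p') (ρ : q ⟶ q') (l3 : p' ⊗ q' ≅ v' ⊗ w') (t3 : v' ⟶ v) (σ : w' ⟶ w)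
    (h : l1.hom ≫ s ◁ t ≫ l2.hom = (t1 ⊗ₘ ρ) ≫ l3.hom ≫ (t3 ⊗ₘ σ)) :
    (asc X Y Z l1).hom ≫ ((β_ X ((Y ⊗ Z) ⊗ s)).hom ⊗ₘ t) ≫ (asc Y Z X l2).hom =
      ((((β_ X Y).hom ⊗ₘ t1) ▷ Z) ⊗ₘ ρ) ≫ (asc Y X Z l3).hom ≫ ((Y ◁ ((β_ X Z).hom ⊗ₘ t3)) ⊗ₘ σ) := by
  simp only [asc_hom, MonoidalCategory.tensorHom_def] at h ⊢
  calc
    _ = 𝟙 _ ⊗≫ (X ⊗ Y) ◁ (β_ Z p).inv ▷ q ⊗≫ (X ⊗ Y ⊗ Z) ◁ l1.hom ⊗≫ (β_ X Y).hom ▷ (Z ⊗ s ⊗ u) ⊗≫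
        Y ◁ (β_ X Z).hom ▷ (s ⊗ u) ⊗≫ (Y ⊗ Z) ◁ (β_ X s).hom ▷ u ⊗≫
        (Y ⊗ Z) ◁ ((s ⊗ X) ◁ t ≫ (β_ X s).inv ▷ u') ⊗≫ (Y ⊗ Z ⊗ X) ◁ l2.hom ⊗≫ 𝟙 _ := by
      simp only [BraidedCategory.braiding_tensor_right_hom]
      monoidal
    _ = 𝟙 _ ⊗≫ (X ⊗ Y) ◁ (β_ Z p).inv ▷ q ⊗≫ (X ⊗ Y ⊗ Z) ◁ l1.hom ⊗≫ (β_ X Y).hom ▷ (Z ⊗ s ⊗ u) ⊗≫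
        Y ◁ (β_ X Z).hom ▷ (s ⊗ u) ⊗≫ (Y ⊗ Z) ◁ ((β_ X s).hom ≫ (β_ X s).inv) ▷ u ⊗≫
        (Y ⊗ Z ⊗ X) ◁ (s ◁ t ≫ l2.hom) ⊗≫ 𝟙 _ := by
      rw [whisker_exchange]; monoidal
    _ = 𝟙 _ ⊗≫ (X ⊗ Y) ◁ (β_ Z p).inv ▷ q ⊗≫ ((X ⊗ Y) ◁ (Z ◁ l1.hom) ≫ (β_ X Y).hom ▷ (Z ⊗ s ⊗ u)) ⊗≫
        Y ◁ (β_ X Z).hom ▷ (s ⊗ u) ⊗≫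
        (Y ⊗ Z ⊗ X) ◁ (s ◁ t ≫ l2.hom) ⊗≫ 𝟙 _ := by
      rw [Iso.hom_inv_id]; monoidal
    _ = 𝟙 _ ⊗≫ ((X ⊗ Y) ◁ (β_ Z p).inv ≫ (β_ X Y).hom ▷ (Z ⊗ p)) ▷ q ⊗≫
        Y ◁ ((X ⊗ Z) ◁ l1.hom ≫ (β_ X Z).hom ▷ (s ⊗ u)) ⊗≫
        (Y ⊗ Z ⊗ X) ◁ (s ◁ t ≫ l2.hom) ⊗≫ 𝟙 _ := by
      rw [whisker_exchange]; monoidal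
    _ = 𝟙 _ ⊗≫ (β_ X Y).hom ▷ (p ⊗ Z ⊗ q) ⊗≫ (Y ⊗ X) ◁ (β_ Z p).inv ▷ q ⊗≫
        Y ◁ (β_ X Z).hom ▷ (p ⊗ q) ⊗≫
        (Y ⊗ Z ⊗ X) ◁ (l1.hom ≫ s ◁ t ≫ l2.hom) ⊗≫ 𝟙 _ := by
      rw [whisker_exchange, whisker_exchange]; monoidal
    _ = 𝟙 _ ⊗≫ (β_ X Y).hom ▷ (p ⊗ Z ⊗ q) ⊗≫ (Y ⊗ X) ◁ (β_ Z p).inv ▷ q ⊗≫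
        Y ◁ ((β_ X Z).hom ▷ (p ⊗ q) ≫
        (Z ⊗ X) ◁ ((t1 ▷ q ≫ p' ◁ ρ) ≫ l3.hom)) ⊗≫ (Y ⊗ Z ⊗ X) ◁ (t3 ▷ w' ≫ v ◁ σ) ⊗≫ 𝟙 _ := by
      rw [h]; monoidal
    _ = 𝟙 _ ⊗≫ (β_ X Y).hom ▷ (p ⊗ Z ⊗ q) ⊗≫ (Y ⊗ X) ◁ ((β_ Z p).inv ≫ Z ◁ t1) ▷ q ⊗≫
        (Y ⊗ X ⊗ Z ⊗ p') ◁ ρ ⊗≫ (Y ⊗ X ⊗ Z) ◁ l3.hom ⊗≫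
        Y ◁ (β_ X Z).hom ▷ (v' ⊗ w') ⊗≫ (Y ⊗ Z ⊗ X) ◁ (t3 ▷ w' ≫ v ◁ σ) ⊗≫ 𝟙 _ := by
      rw [← whisker_exchange]; monoidal
    _ = 𝟙 _ ⊗≫ (β_ X Y).hom ▷ (p ⊗ Z ⊗ q) ⊗≫ (Y ⊗ X) ◁ (t1 ▷ (Z ⊗ q)) ⊗≫
        (Y ⊗ X) ◁ ((β_ Z p').inv ▷ q ≫ (Z ⊗ p') ◁ ρ) ⊗≫ (Y ⊗ X ⊗ Z) ◁ l3.hom ⊗≫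
        Y ◁ (β_ X Z).hom ▷ (v' ⊗ w') ⊗≫ (Y ⊗ Z ⊗ X) ◁ (t3 ▷ w' ≫ v ◁ σ) ⊗≫ 𝟙 _ := by
      rw [← BraidedCategory.braiding_inv_naturality_left]; monoidal
    _ = _ := by
      rw [← whisker_exchange]; monoidal

section lin
variable {k : Type*} [Field k] [Preadditive C] [Linear k C] [MonoidalPreadditive C] [MonoidalLinear k C]

lemma hexR (X Y Z : C) {p q s u q' s' u' v w m n : C}
    (l1 : p ⊗ q ≅ s ⊗ u) (t : q ⟶ q') (l2 : v ⊗ w ≅ p ⊗ q')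
    (t1 : s ⟶ s') (ρ : u ⟶ u') (l3 : m ⊗ n ≅ s' ⊗ u') (t3 : m ⟶ v) (σ : n ⟶ w) (ω : k)
    (hω : (β_ Z p).hom ≫ (β_ p Z).hom = ω • 𝟙 (Z ⊗ p))
    (h : ω • (l1.inv ≫ p ◁ t ≫ l2.inv) = (t1 ⊗ₘ ρ) ≫ l3.inv ≫ (t3 ⊗ₘ σ)) :
    (asc X Y Z l1).inv ≫ ((β_ ((X ⊗ Y) ⊗ p) Z).hom ⊗ₘ t) ≫ (asc Z X Y l2).inv =
      ((X ◁ ((β_ Y Z).hom ⊗ₘ t1)) ⊗ₘ ρ) ≫ (asc X Z Y l3).inv ≫ ((((β_ X Z).hom ⊗ₘ t3) ▷ Y) ⊗ₘ σ) := by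
  simp only [asc_inv, MonoidalCategory.tensorHom_def] at h ⊢
  calc
    _ = 𝟙 _ ⊗≫ (X ⊗ Y ⊗ Z) ◁ l1.inv ⊗≫ (X ⊗ Y) ◁ ((β_ Z p).hom ≫ (β_ p Z).hom) ▷ q ⊗≫
        X ◁ (β_ Y Z).hom ▷ (p ⊗ q) ⊗≫ (β_ X Z).hom ▷ (Y ⊗ p ⊗ q) ⊗≫
        (Z ⊗ X ⊗ Y) ◁ (p ◁ t ≫ l2.inv) ⊗≫ (Z ⊗ X) ◁ (β_ Y v).hom ▷ w ⊗≫ 𝟙 _ := by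
      simp only [BraidedCategory.braiding_tensor_left_hom]
      monoidal
    _ = ω • (𝟙 _ ⊗≫ (X ⊗ Y ⊗ Z) ◁ l1.inv ⊗≫
        X ◁ (β_ Y Z).hom ▷ (p ⊗ q) ⊗≫ ((β_ X Z).hom ▷ (Y ⊗ p ⊗ q) ≫
        (Z ⊗ X) ◁ (Y ◁ (p ◁ t ≫ l2.inv))) ⊗≫ (Z ⊗ X) ◁ (β_ Y v).hom ▷ w ⊗≫ 𝟙 _) := by
      rw [hω]
      simp only [monoidalComp, MonoidalLinear.whiskerLeft_smul, MonoidalLinear.smul_whiskerRight, Linear.smul_comp, Linear.comp_smul]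
      congr 1
      monoidal
    _ = ω • (𝟙 _ ⊗≫ (X ⊗ Y ⊗ Z) ◁ l1.inv ⊗≫
        X ◁ ((β_ Y Z).hom ▷ (p ⊗ q) ≫ (Z ⊗ Y) ◁ (p ◁ t ≫ l2.inv)) ⊗≫ ((β_ X Z).hom ▷ ((Y ⊗ v) ⊗ w) ≫
        (Z ⊗ X) ◁ ((β_ Y v).hom ▷ w)) ⊗≫ 𝟙 _) := by
      rw [← whisker_exchange]
      congr 1
      monoidal
    _ = ω • (𝟙 _ ⊗≫ (X ⊗ Y ⊗ Z) ◁ (l1.inv ≫ p ◁ t ≫ l2.inv) ⊗≫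
        X ◁ ((β_ Y Z).hom ▷ (v ⊗ w)) ⊗≫
        X ◁ Z ◁ (β_ Y v).hom ▷ w ⊗≫ (β_ X Z).hom ▷ (v ⊗ Y ⊗ w) ⊗≫ 𝟙 _) := by
      rw [← whisker_exchange, ← whisker_exchange]
      congr 1
      monoidal
    _ = 𝟙 _ ⊗≫ (X ⊗ Y ⊗ Z) ◁ (ω • (l1.inv ≫ p ◁ t ≫ l2.inv)) ⊗≫
        X ◁ ((β_ Y Z).hom ▷ (v ⊗ w)) ⊗≫
        X ◁ Z ◁ (β_ Y v).hom ▷ w ⊗≫ (β_ X Z).hom ▷ (v ⊗ Y ⊗ w) ⊗≫ 𝟙 _ := by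
      simp only [monoidalComp, MonoidalLinear.whiskerLeft_smul, Linear.smul_comp, Linear.comp_smul]
    _ = 𝟙 _ ⊗≫ X ◁ ((Y ⊗ Z) ◁ ((t1 ▷ u ≫ s' ◁ ρ) ≫ l3.inv ≫ (t3 ▷ n ≫ v ◁ σ)) ≫
        (β_ Y Z).hom ▷ (v ⊗ w)) ⊗≫
        X ◁ Z ◁ (β_ Y v).hom ▷ w ⊗≫ (β_ X Z).hom ▷ (v ⊗ Y ⊗ w) ⊗≫ 𝟙 _ := by
      rw [h]; monoidal
    _ = 𝟙 _ ⊗≫ X ◁ (β_ Y Z).hom ▷ (s ⊗ u) ⊗≫ (X ⊗ Z ⊗ Y) ◁ ((t1 ▷ u ≫ s' ◁ ρ) ≫ l3.inv ≫ t3 ▷ n) ⊗≫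
        X ◁ Z ◁ ((Y ⊗ v) ◁ σ ≫ (β_ Y v).hom ▷ w) ⊗≫ (β_ X Z).hom ▷ (v ⊗ Y ⊗ w) ⊗≫ 𝟙 _ := by
      rw [whisker_exchange]; monoidal
    _ = 𝟙 _ ⊗≫ X ◁ (β_ Y Z).hom ▷ (s ⊗ u) ⊗≫ (X ⊗ Z ⊗ Y) ◁ ((t1 ▷ u ≫ s' ◁ ρ) ≫ l3.inv) ⊗≫
        X ◁ Z ◁ (Y ◁ t3 ≫ (β_ Y v).hom) ▷ n ⊗≫ (X ⊗ Z) ◁ ((v ⊗ Y) ◁ σ) ⊗≫ (β_ X Z).hom ▷ (v ⊗ Y ⊗ w) ⊗≫ 𝟙 _ := by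
      rw [whisker_exchange]; monoidal
    _ = 𝟙 _ ⊗≫ X ◁ (β_ Y Z).hom ▷ (s ⊗ u) ⊗≫ (X ⊗ Z ⊗ Y) ◁ ((t1 ▷ u ≫ s' ◁ ρ) ≫ l3.inv) ⊗≫
        (X ⊗ Z) ◁ (β_ Y m).hom ▷ n ⊗≫
        ((X ⊗ Z) ◁ (t3 ▷ (Y ⊗ n) ≫ v ◁ Y ◁ σ) ≫ (β_ X Z).hom ▷ (v ⊗ Y ⊗ w)) ⊗≫ 𝟙 _ := by
      rw [BraidedCategory.braiding_naturality_right]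
      monoidal
    _ = _ := by
      rw [whisker_exchange]
      monoidal
end lin

section dual
variable {X Xd b p q e1 e1' e2 e2' : C} [ExactPairing X Xd]

/-- The zested coevaluation, on underlying objects. -/
def coevRaw (X Xd : C) [ExactPairing X Xd] (η : 𝟙_ C ≅ b ⊗ p) : 𝟙_ C ⟶ (X ⊗ (Xd ⊗ b)) ⊗ p :=
  η_ X Xd ⊗≫ (X ⊗ Xd) ◁ η.hom ⊗≫ 𝟙 _

/-- The zested evaluation, on underlying objects: `b` passes under `X`. -/
def evRaw (X Xd : C) [ExactPairing X Xd] (κ : b ⊗ q ≅ 𝟙_ C) : ((Xd ⊗ b) ⊗ X) ⊗ q ⟶ 𝟙_ C :=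
  𝟙 _ ⊗≫ Xd ◁ (β_ X b).inv ▷ q ⊗≫ ε_ X Xd ▷ (b ⊗ q) ⊗≫ κ.hom

lemma zig1 (η : 𝟙_ C ≅ b ⊗ p) (φ : p ≅ q) (l : p ⊗ e1 ≅ q ⊗ e2) (t1 : e1' ⟶ e1) (t2 : e2 ⟶ e2')
    (L : e1' ≅ 𝟙_ C) (R : e2' ≅ 𝟙_ C)
    (h : p ◁ t1 ≫ l.hom ≫ q ◁ t2 = p ◁ L.hom ≫ φ.hom ▷ 𝟙_ C ≫ q ◁ R.inv) :
    (coevRaw X Xd η ▷ X ⊗ₘ t1) ≫ (asc X (Xd ⊗ b) X l).hom ≫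
      (X ◁ evRaw X Xd (whiskerLeftIso b φ.symm ≪≫ η.symm) ⊗ₘ t2) =
    (((λ_ X).hom ⊗ₘ L.hom) ≫ (ρ_ X).hom) ≫ ((ρ_ X).inv ≫ ((ρ_ X).inv ⊗ₘ R.inv)) := by
  simp only [asc_hom, MonoidalCategory.tensorHom_def, coevRaw, evRaw, Iso.trans_hom, whiskerLeftIso_hom, Iso.symm_hom]
  calc
    _ = 𝟙 _ ⊗≫ η_ X Xd ▷ (X ⊗ e1') ⊗≫ (X ⊗ Xd) ◁ η.hom ▷ (X ⊗ e1') ⊗≫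
        (X ⊗ Xd ⊗ b) ◁ ((p ⊗ X) ◁ t1 ≫ (β_ X p).inv ▷ e1) ⊗≫ (X ⊗ Xd ⊗ b ⊗ X) ◁ l.hom ⊗≫
        X ◁ Xd ◁ (β_ X b).inv ▷ (q ⊗ e2) ⊗≫ X ◁ (ε_ X Xd ▷ (b ⊗ q ⊗ e2)) ⊗≫
        X ◁ ((b ◁ φ.inv ≫ η.inv) ▷ e2 ≫ 𝟙_ C ◁ t2) ⊗≫ 𝟙 _ := by
      monoidal
    _ = 𝟙 _ ⊗≫ η_ X Xd ▷ (X ⊗ e1') ⊗≫ (X ⊗ Xd) ◁ η.hom ▷ (X ⊗ e1') ⊗≫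
        (X ⊗ Xd ⊗ b) ◁ (β_ X p).inv ▷ e1' ⊗≫ (X ⊗ Xd ⊗ b ⊗ X) ◁ (p ◁ t1 ≫ l.hom) ⊗≫
        X ◁ Xd ◁ (β_ X b).inv ▷ (q ⊗ e2) ⊗≫
        X ◁ (ε_ X Xd ▷ ((b ⊗ q) ⊗ e2) ≫ 𝟙_ C ◁ ((b ⊗ q) ◁ t2)) ⊗≫
        X ◁ (b ◁ φ.inv ≫ η.inv) ▷ e2' ⊗≫ 𝟙 _ := by
      rw [← whisker_exchange, whisker_exchange]; monoidal
    _ = 𝟙 _ ⊗≫ η_ X Xd ▷ (X ⊗ e1') ⊗≫ (X ⊗ Xd) ◁ η.hom ▷ (X ⊗ e1') ⊗≫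
        (X ⊗ Xd ⊗ b) ◁ (β_ X p).inv ▷ e1' ⊗≫ (X ⊗ Xd ⊗ b ⊗ X) ◁ (p ◁ t1 ≫ l.hom) ⊗≫
        X ◁ Xd ◁ ((β_ X b).inv ▷ (q ⊗ e2) ≫ (X ⊗ b) ◁ (q ◁ t2)) ⊗≫ X ◁ (ε_ X Xd ▷ (b ⊗ q ⊗ e2')) ⊗≫
        X ◁ (b ◁ φ.inv ≫ η.inv) ▷ e2' ⊗≫ 𝟙 _ := by
      rw [← whisker_exchange]; monoidal
    _ = 𝟙 _ ⊗≫ η_ X Xd ▷ (X ⊗ e1') ⊗≫ (X ⊗ Xd) ◁ η.hom ▷ (X ⊗ e1') ⊗≫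
        (X ⊗ Xd ⊗ b) ◁ (β_ X p).inv ▷ e1' ⊗≫ X ◁ Xd ◁ ((b ⊗ X) ◁ (p ◁ t1 ≫ l.hom ≫ q ◁ t2) ≫
        (β_ X b).inv ▷ (q ⊗ e2')) ⊗≫ X ◁ (ε_ X Xd ▷ (b ⊗ q ⊗ e2')) ⊗≫
        X ◁ (b ◁ φ.inv ≫ η.inv) ▷ e2' ⊗≫ 𝟙 _ := by
      rw [← whisker_exchange]; monoidal
    _ = 𝟙 _ ⊗≫ η_ X Xd ▷ (X ⊗ e1') ⊗≫ (X ⊗ Xd) ◁ (η.hom ▷ X ≫ (β_ X (b ⊗ p)).inv) ▷ e1' ⊗≫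
        X ◁ ((Xd ⊗ X) ◁ (b ◁ (p ◁ L.hom ≫ φ.hom ▷ 𝟙_ C ≫ q ◁ R.inv)) ≫ ε_ X Xd ▷ (b ⊗ q ⊗ e2')) ⊗≫
        X ◁ (b ◁ φ.inv ≫ η.inv) ▷ e2' ⊗≫ 𝟙 _ := by
      rw [h, whisker_exchange, BraidedCategory.braiding_tensor_right_inv]; monoidal
    _ = 𝟙 _ ⊗≫ η_ X Xd ▷ (X ⊗ e1') ⊗≫ (X ⊗ Xd) ◁ ((β_ X (𝟙_ C)).inv ≫ X ◁ η.hom) ▷ e1' ⊗≫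
        X ◁ (ε_ X Xd ▷ (b ⊗ p ⊗ e1')) ⊗≫ X ◁ (b ◁ (p ◁ L.hom ≫ φ.hom ▷ 𝟙_ C ≫ q ◁ R.inv)) ⊗≫
        X ◁ (b ◁ φ.inv ≫ η.inv) ▷ e2' ⊗≫ 𝟙 _ := by
      rw [whisker_exchange, BraidedCategory.braiding_inv_naturality_left]; monoidal
    _ = 𝟙 _ ⊗≫ η_ X Xd ▷ (X ⊗ e1') ⊗≫ X ◁ ((Xd ⊗ X) ◁ (η.hom ▷ e1') ≫ ε_ X Xd ▷ ((b ⊗ p) ⊗ e1')) ⊗≫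
        X ◁ (b ⊗ p) ◁ L.hom ⊗≫ X ◁ b ◁ φ.hom ⊗≫ X ◁ ((b ⊗ q) ◁ R.inv ≫ (b ◁ φ.inv) ▷ e2') ⊗≫
        X ◁ η.inv ▷ e2' ⊗≫ 𝟙 _ := by
      rw [braiding_inv_tensorUnit_right]; monoidal
    _ = 𝟙 _ ⊗≫ (η_ X Xd ▷ X ⊗≫ X ◁ ε_ X Xd) ▷ e1' ⊗≫ X ◁ (η.hom ▷ e1' ≫ (b ⊗ p) ◁ L.hom) ⊗≫
        X ◁ b ◁ (φ.hom ≫ φ.inv) ⊗≫ X ◁ ((b ⊗ p) ◁ R.inv ≫ η.inv ▷ e2') ⊗≫ 𝟙 _ := by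
      rw [whisker_exchange, whisker_exchange]; monoidal
    _ = 𝟙 _ ⊗≫ X ◁ L.hom ⊗≫ X ◁ (η.hom ≫ η.inv) ⊗≫ X ◁ R.inv ⊗≫ 𝟙 _ := by
      rw [ExactPairing.evaluation_coevaluation'', Iso.hom_inv_id, ← whisker_exchange η.hom L.hom,
        whisker_exchange η.inv R.inv]
      monoidal
    _ = _ := by
      rw [Iso.hom_inv_id]; monoidal

lemma zig2Core (κ : b ⊗ q ≅ 𝟙_ C) :
    𝟙 (Xd ⊗ b ⊗ q) ⊗≫ (Xd ⊗ b) ◁ η_ X Xd ▷ q ⊗≫ (Xd ⊗ b ⊗ X) ◁ (β_ Xd q).hom ⊗≫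
      Xd ◁ (β_ X b).inv ▷ (q ⊗ Xd) ⊗≫ ε_ X Xd ▷ (b ⊗ q ⊗ Xd) ⊗≫ κ.hom ▷ Xd ⊗≫ 𝟙 Xd =
    Xd ◁ κ.hom ⊗≫ 𝟙 Xd := by
  have hk : κ.hom ▷ Xd = (β_ Xd (b ⊗ q)).inv ≫ Xd ◁ κ.hom ≫ (β_ Xd (𝟙_ C)).hom := by
    rw [← BraidedCategory.braiding_inv_naturality_left_assoc]; simp
  calc
    _ = 𝟙 (Xd ⊗ b ⊗ q) ⊗≫ (Xd ⊗ b) ◁ η_ X Xd ▷ q ⊗≫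
      Xd ◁ ((b ⊗ X) ◁ (β_ Xd q).hom ≫ (β_ X b).inv ▷ (q ⊗ Xd)) ⊗≫ ε_ X Xd ▷ (b ⊗ q ⊗ Xd) ⊗≫
      (b ◁ (β_ Xd q).inv ⊗≫ (β_ Xd b).inv ▷ q) ⊗≫ Xd ◁ κ.hom ⊗≫ (β_ Xd (𝟙_ C)).hom ⊗≫ 𝟙 _ := by
      rw [hk, BraidedCategory.braiding_tensor_right_inv]; monoidal
    _ = 𝟙 (Xd ⊗ b ⊗ q) ⊗≫ (Xd ⊗ b) ◁ η_ X Xd ▷ q ⊗≫ Xd ◁ (β_ X b).inv ▷ (Xd ⊗ q) ⊗≫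
      ((Xd ⊗ X) ◁ (b ◁ (β_ Xd q).hom) ≫ ε_ X Xd ▷ (b ⊗ q ⊗ Xd)) ⊗≫
      (b ◁ (β_ Xd q).inv ⊗≫ (β_ Xd b).inv ▷ q) ⊗≫ Xd ◁ κ.hom ⊗≫ 𝟙 _ := by
      rw [whisker_exchange, braiding_tensorUnit_right]; monoidal
    _ = 𝟙 (Xd ⊗ b ⊗ q) ⊗≫ (Xd ⊗ b) ◁ η_ X Xd ▷ q ⊗≫ Xd ◁ (β_ X b).inv ▷ (Xd ⊗ q) ⊗≫
      ε_ X Xd ▷ (b ⊗ Xd ⊗ q) ⊗≫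
      (b ◁ ((β_ Xd q).hom ≫ (β_ Xd q).inv) ⊗≫ (β_ Xd b).inv ▷ q) ⊗≫ Xd ◁ κ.hom ⊗≫ 𝟙 _ := by
      rw [whisker_exchange]; monoidal
    _ = 𝟙 (Xd ⊗ b ⊗ q) ⊗≫ (Xd ⊗ b) ◁ η_ X Xd ▷ q ⊗≫ Xd ◁ (β_ X b).inv ▷ (Xd ⊗ q) ⊗≫
      (ε_ X Xd ▷ (b ⊗ Xd) ≫ 𝟙_ C ◁ (β_ Xd b).inv) ▷ q ⊗≫ Xd ◁ κ.hom ⊗≫ 𝟙 _ := by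
      rw [Iso.hom_inv_id]; monoidal
    _ = 𝟙 (Xd ⊗ b ⊗ q) ⊗≫ Xd ◁ (b ◁ η_ X Xd ≫ (β_ (X ⊗ Xd) b).inv) ▷ q ⊗≫
      ε_ X Xd ▷ (Xd ⊗ b ⊗ q) ⊗≫ Xd ◁ κ.hom ⊗≫ 𝟙 _ := by
      rw [← whisker_exchange, BraidedCategory.braiding_tensor_left_inv]; monoidal
    _ = 𝟙 (Xd ⊗ b ⊗ q) ⊗≫ (Xd ◁ η_ X Xd ⊗≫ ε_ X Xd ▷ Xd) ▷ (b ⊗ q) ⊗≫ Xd ◁ κ.hom ⊗≫ 𝟙 _ := by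
      rw [BraidedCategory.braiding_inv_naturality_right, braiding_inv_tensorUnit_left]; monoidal
    _ = _ := by
      rw [ExactPairing.coevaluation_evaluation'']; monoidal

lemma zig2 (η : 𝟙_ C ≅ b ⊗ p) (κ : b ⊗ q ≅ 𝟙_ C) {e3 e3' e4 e4' : C} (l : q ⊗ e3 ≅ p ⊗ e4)
    (t3 : e4' ≅ e4) (t4 : e3 ≅ e3') :
    IsIso (((Xd ⊗ b) ◁ coevRaw X Xd η ⊗ₘ t3.hom) ≫ (asc (Xd ⊗ b) X (Xd ⊗ b) l).inv ≫
      (evRaw X Xd κ ▷ (Xd ⊗ b) ⊗ₘ t4.hom)) := by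
  have : ((Xd ⊗ b) ◁ coevRaw X Xd η ⊗ₘ t3.hom) ≫ (asc (Xd ⊗ b) X (Xd ⊗ b) l).inv ≫
      (evRaw X Xd κ ▷ (Xd ⊗ b) ⊗ₘ t4.hom) =
      𝟙 _ ⊗≫ (Xd ⊗ b) ◁ η.hom ▷ e4' ⊗≫ (Xd ⊗ b ⊗ b ⊗ p) ◁ t3.hom ⊗≫ (Xd ⊗ b ⊗ b) ◁ l.inv ⊗≫
        (Xd ⊗ b) ◁ (β_ b q).hom ▷ e3 ⊗≫ Xd ◁ κ.hom ▷ (b ⊗ e3) ⊗≫ (Xd ⊗ b) ◁ t4.hom ⊗≫ 𝟙 _ := by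
    simp only [asc_inv, MonoidalCategory.tensorHom_def, coevRaw, evRaw]
    calc
      _ = 𝟙 _ ⊗≫ (Xd ⊗ b) ◁ (η_ X Xd ▷ e4' ≫ (X ⊗ Xd) ◁ (𝟙 e4' ⊗≫ η.hom ▷ e4' ⊗≫ (b ⊗ p) ◁ t3.hom ⊗≫
        b ◁ l.inv ⊗≫ (β_ b q).hom ▷ e3)) ⊗≫
        (Xd ⊗ b ⊗ X) ◁ (β_ Xd q).hom ▷ (b ⊗ e3) ⊗≫
        Xd ◁ (β_ X b).inv ▷ (q ⊗ Xd ⊗ b ⊗ e3) ⊗≫ ε_ X Xd ▷ (b ⊗ q ⊗ Xd ⊗ b ⊗ e3) ⊗≫ κ.hom ▷ (Xd ⊗ b ⊗ e3)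
        ⊗≫ (Xd ⊗ b) ◁ t4.hom ⊗≫ 𝟙 _ := by
        simp only [BraidedCategory.braiding_tensor_left_hom]; monoidal
      _ = 𝟙 _ ⊗≫ (Xd ⊗ b) ◁ (𝟙 e4' ⊗≫ η.hom ▷ e4' ⊗≫ (b ⊗ p) ◁ t3.hom ⊗≫
        b ◁ l.inv ⊗≫ (β_ b q).hom ▷ e3) ⊗≫ (𝟙 (Xd ⊗ b ⊗ q) ⊗≫ (Xd ⊗ b) ◁ η_ X Xd ▷ q ⊗≫ (Xd ⊗ b ⊗ X) ◁ (β_ Xd q).hom ⊗≫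
      Xd ◁ (β_ X b).inv ▷ (q ⊗ Xd) ⊗≫ ε_ X Xd ▷ (b ⊗ q ⊗ Xd) ⊗≫ κ.hom ▷ Xd ⊗≫ 𝟙 Xd) ▷ (b ⊗ e3)
        ⊗≫ (Xd ⊗ b) ◁ t4.hom ⊗≫ 𝟙 _ := by
        rw [← whisker_exchange]; monoidal
      _ = _ := by
        rw [zig2Core]; monoidal
  rw [this]
  simp only [monoidalComp]
  infer_instance
end dual

end Raw

/-! ### The zested ribbon category -/

section ZestedCategory

variable {k : Type*} [Field k] {C : Type u} [Category.{v} C] [Abelian C] [Linear k C]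
  [MonoidalCategory C] [MonoidalPreadditive C] [MonoidalLinear k C] [BraidedCategory C]
  [RightRigidCategory C] [RibbonCategory C] {A : Type*} [CommGroup A] {G : Grading A C}

namespace Zested

variable {Z : RibbonZesting k G}

/-- Morphisms of the zested category are the morphisms of `C`. -/
@[ext]
structure Hom (X Y : Zested Z) where
  hom : X.obj ⟶ Y.obj

instance : Category (Zested Z) where
  Hom := Hom
  id X := ⟨𝟙 X.obj⟩
  comp f g := ⟨f.hom ≫ g.hom⟩

@[ext]
lemma hom_ext {X Y : Zested Z} {f g : X ⟶ Y} (h : f.hom = g.hom) : f = g := Hom.ext h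

@[simp] lemma id_hom (X : Zested Z) : Hom.hom (𝟙 X) = 𝟙 X.obj := rfl

@[simp] lemma comp_hom {X Y W : Zested Z} (f : X ⟶ Y) (g : Y ⟶ W) :
    (f ≫ g).hom = f.hom ≫ g.hom := rfl

/-- An isomorphism in `C` between homogeneous objects is one in the zested category. -/
def mkIso {X Y : Zested Z} (e : X.obj ≅ Y.obj) : X ≅ Y where
  hom := ⟨e.hom⟩
  inv := ⟨e.inv⟩
  hom_inv_id := by ext; simp
  inv_hom_id := by ext; simp

@[simp] lemma mkIso_hom_hom {X Y : Zested Z} (e : X.obj ≅ Y.obj) : (mkIso e).hom.hom = e.hom := rfl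

@[simp] lemma mkIso_inv_hom {X Y : Zested Z} (e : X.obj ≅ Y.obj) : (mkIso e).inv.hom = e.inv := rfl

lemma grade_eq_or_eq_zero {X Y : Zested Z} (f : X ⟶ Y) : X.grade = Y.grade ∨ f.hom = 0 := by
  by_cases h : X.grade = Y.grade
  · exact Or.inl h
  · exact Or.inr (G.hom_eq_zero X.mem Y.mem h _)

end Zested

/-- The identity of `λ(a,b)` if `(a,b) = (a',b')`, and zero otherwise. -/
noncomputable def lamMap (lam : A → A → C) (a b a' b' : A) : lam a b ⟶ lam a' b' :=
  open Classical in if h : a = a' ∧ b = b' then (lamCast lam h.1 h.2).hom else 0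

@[simp] lemma lamCast_rfl (lam : A → A → C) {a b : A} (ha : a = a) (hb : b = b) :
    lamCast lam ha hb = Iso.refl _ := rfl

@[simp] lemma lamMap_self (lam : A → A → C) (a b : A) : lamMap lam a b a b = 𝟙 _ := by
  simp [lamMap]

lemma lamMap_eq (lam : A → A → C) {a b a' b' : A} (ha : a = a') (hb : b = b') :
    lamMap lam a b a' b' = (lamCast lam ha hb).hom := by
  subst ha hb; simp

namespace Zested

variable {Z : RibbonZesting k G}

variable {D : Type u} [Category.{v} D] [MonoidalCategory D] in
lemma leftUnit_nat {X Y p : D} (f : X ⟶ Y) (m : p ⟶ 𝟙_ D) :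
    ((𝟙 (𝟙_ D) ⊗ₘ f) ⊗ₘ 𝟙 p) ≫ ((λ_ Y).hom ⊗ₘ m) ≫ (ρ_ Y).hom =
      (((λ_ X).hom ⊗ₘ m) ≫ (ρ_ X).hom) ≫ f := by
  have h : (λ_ X).hom ≫ f ⊗ₘ m = ((λ_ X).hom ⊗ₘ m) ≫ (f ▷ 𝟙_ D) := by
    rw [← tensorHom_id, tensorHom_comp_tensorHom, Category.comp_id]
  rw [tensorHom_comp_tensorHom_assoc, Category.id_comp, Category.assoc,
    ← rightUnitor_naturality, ← Category.assoc _ (f ▷ 𝟙_ D), ← h]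
  simp

variable {D : Type u} [Category.{v} D] [MonoidalCategory D] in
lemma rightUnit_nat {X Y p : D} (f : X ⟶ Y) (m : p ⟶ 𝟙_ D) :
    ((f ⊗ₘ 𝟙 (𝟙_ D)) ⊗ₘ 𝟙 p) ≫ ((ρ_ Y).hom ⊗ₘ m) ≫ (ρ_ Y).hom =
      (((ρ_ X).hom ⊗ₘ m) ≫ (ρ_ X).hom) ≫ f := by
  have h : (ρ_ X).hom ≫ f ⊗ₘ m = ((ρ_ X).hom ⊗ₘ m) ≫ (f ▷ 𝟙_ D) := by
    rw [← tensorHom_id, tensorHom_comp_tensorHom, Category.comp_id]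
  rw [tensorHom_comp_tensorHom_assoc, Category.id_comp, Category.assoc,
    ← rightUnitor_naturality, ← Category.assoc _ (f ▷ 𝟙_ D), ← h]
  simp

lemma braid_nat_right (X : C) {Y Y' p q : C} (g : Y ⟶ Y') (t : p ⟶ q) :
    ((𝟙 X ⊗ₘ g) ⊗ₘ 𝟙 p) ≫ ((β_ X Y').hom ⊗ₘ t) =
      ((β_ X Y).hom ⊗ₘ t) ≫ ((g ⊗ₘ 𝟙 X) ⊗ₘ 𝟙 q) := by
  rw [tensorHom_comp_tensorHom, tensorHom_comp_tensorHom]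
  simp

lemma braid_nat_left {X X' p q : C} (f : X ⟶ X') (Y : C) (t : p ⟶ q) :
    ((f ⊗ₘ 𝟙 Y) ⊗ₘ 𝟙 p) ≫ ((β_ X' Y).hom ⊗ₘ t) =
      ((β_ X Y).hom ⊗ₘ t) ≫ ((𝟙 Y ⊗ₘ f) ⊗ₘ 𝟙 q) := by
  rw [tensorHom_comp_tensorHom, tensorHom_comp_tensorHom]
  simp

/-- The zested tensor product `X ⊗' Y = (X ⊗ Y) ⊗ λ(a,b)` of `X ∈ C_a` and `Y ∈ C_b`, with
associator `asc X Y Z λ_{a,b,c}`. -/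
noncomputable instance : MonoidalCategoryStruct (Zested Z) where
  tensorObj X Y := ⟨X.grade * Y.grade, (X.obj ⊗ Y.obj) ⊗ Z.lam X.grade Y.grade, by
    simpa using G.tensor_mem (G.tensor_mem X.mem Y.mem) (Z.lam_mem X.grade Y.grade)⟩
  tensorHom {X X' Y Y'} f g := ⟨(f.hom ⊗ₘ g.hom) ⊗ₘ lamMap Z.lam X.grade Y.grade X'.grade Y'.grade⟩
  whiskerLeft X Y Y' g := ⟨(𝟙 X.obj ⊗ₘ g.hom) ⊗ₘ lamMap Z.lam X.grade Y.grade X.grade Y'.grade⟩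
  whiskerRight {X X'} f Y := ⟨(f.hom ⊗ₘ 𝟙 Y.obj) ⊗ₘ lamMap Z.lam X.grade Y.grade X'.grade Y.grade⟩
  tensorUnit := ⟨1, 𝟙_ C, G.unit_mem⟩
  associator X Y W := mkIso (asc X.obj Y.obj W.obj (Z.assoc X.grade Y.grade W.grade))
  leftUnitor X := mkIso (((λ_ X.obj) ⊗ᵢ (Z.unitL X.grade)) ≪≫ ρ_ X.obj)
  rightUnitor X := mkIso (((ρ_ X.obj) ⊗ᵢ (Z.unitR X.grade)) ≪≫ ρ_ X.obj)

lemma tensorObj_obj (X Y : Zested Z) : (X ⊗ Y).obj = (X.obj ⊗ Y.obj) ⊗ Z.lam X.grade Y.grade := rfl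

lemma tensorObj_grade (X Y : Zested Z) : (X ⊗ Y).grade = X.grade * Y.grade := rfl

lemma tensorUnit_obj : (𝟙_ (Zested Z)).obj = 𝟙_ C := rfl

lemma tensorUnit_grade : (𝟙_ (Zested Z)).grade = 1 := rfl

lemma tensorHom_hom {X X' Y Y' : Zested Z} (f : X ⟶ X') (g : Y ⟶ Y') : (f ⊗ₘ g).hom =
    (f.hom ⊗ₘ g.hom) ⊗ₘ lamMap Z.lam X.grade Y.grade X'.grade Y'.grade := rfl

lemma whiskerLeft_hom (X : Zested Z) {Y Y' : Zested Z} (g : Y ⟶ Y') : (X ◁ g).hom =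
    (𝟙 X.obj ⊗ₘ g.hom) ⊗ₘ lamMap Z.lam X.grade Y.grade X.grade Y'.grade := rfl

lemma whiskerRight_hom {X X' : Zested Z} (f : X ⟶ X') (Y : Zested Z) : (f ▷ Y).hom =
    (f.hom ⊗ₘ 𝟙 Y.obj) ⊗ₘ lamMap Z.lam X.grade Y.grade X'.grade Y.grade := rfl

lemma associator_def (X Y W : Zested Z) :
    α_ X Y W = mkIso (asc X.obj Y.obj W.obj (Z.assoc X.grade Y.grade W.grade)) := rfl

lemma leftUnitor_def (X : Zested Z) :
    λ_ X = mkIso (((λ_ X.obj) ⊗ᵢ (Z.unitL X.grade)) ≪≫ ρ_ X.obj) := rfl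

lemma rightUnitor_def (X : Zested Z) :
    ρ_ X = mkIso (((ρ_ X.obj) ⊗ᵢ (Z.unitR X.grade)) ≪≫ ρ_ X.obj) := rfl

lemma zero_tensorHom {X X' Y Y' : C} (g : Y ⟶ Y') : (0 : X ⟶ X') ⊗ₘ g = 0 := by
  simp [MonoidalCategory.tensorHom_def]

lemma tensorHom_zero {X X' Y Y' : C} (f : X ⟶ X') : f ⊗ₘ (0 : Y ⟶ Y') = 0 := by
  simp [MonoidalCategory.tensorHom_def]

lemma tensorHom_hom_zero_left {X X' Y Y' : Zested Z} (f : X ⟶ X') (g : Y ⟶ Y') (hf : f.hom = 0) :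
    (f ⊗ₘ g).hom = 0 := by
  rw [tensorHom_hom, hf, zero_tensorHom, zero_tensorHom]

lemma tensorHom_hom_zero_right {X X' Y Y' : Zested Z} (f : X ⟶ X') (g : Y ⟶ Y') (hg : g.hom = 0) :
    (f ⊗ₘ g).hom = 0 := by
  rw [tensorHom_hom, hg, tensorHom_zero, zero_tensorHom]

lemma id_tensorHom_id' (X Y : Zested Z) : 𝟙 X ⊗ₘ 𝟙 Y = 𝟙 (X ⊗ Y) := by
  ext
  rw [tensorHom_hom]
  simp [tensorObj_obj]

lemma tensorHom_comp' {X₁ Y₁ Z₁ X₂ Y₂ Z₂ : Zested Z} (f₁ : X₁ ⟶ Y₁) (f₂ : X₂ ⟶ Y₂) (g₁ : Y₁ ⟶ Z₁)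
    (g₂ : Y₂ ⟶ Z₂) : (f₁ ⊗ₘ f₂) ≫ (g₁ ⊗ₘ g₂) = (f₁ ≫ g₁) ⊗ₘ (f₂ ≫ g₂) := by
  ext
  rw [comp_hom]
  rcases grade_eq_or_eq_zero f₁ with h1 | h1
  swap
  · rw [tensorHom_hom_zero_left _ _ h1,
      tensorHom_hom_zero_left (f₁ ≫ g₁) _ (by rw [comp_hom, h1, zero_comp]), zero_comp]
  rcases grade_eq_or_eq_zero f₂ with h2 | h2
  swap
  · rw [tensorHom_hom_zero_right _ _ h2,
      tensorHom_hom_zero_right _ (f₂ ≫ g₂) (by rw [comp_hom, h2, zero_comp]), zero_comp]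
  obtain ⟨a, X₁, hX₁⟩ := X₁
  obtain ⟨b, X₂, hX₂⟩ := X₂
  obtain ⟨_, Y₁, hY₁⟩ := Y₁
  obtain ⟨_, Y₂, hY₂⟩ := Y₂
  dsimp only at h1 h2
  subst h1 h2
  simp only [tensorHom_hom, comp_hom, lamMap_self, tensorHom_comp_tensorHom, Category.id_comp]

lemma associator_naturality' {X₁ X₂ X₃ Y₁ Y₂ Y₃ : Zested Z} (f₁ : X₁ ⟶ Y₁) (f₂ : X₂ ⟶ Y₂)
    (f₃ : X₃ ⟶ Y₃) : ((f₁ ⊗ₘ f₂) ⊗ₘ f₃) ≫ (α_ Y₁ Y₂ Y₃).hom =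
      (α_ X₁ X₂ X₃).hom ≫ (f₁ ⊗ₘ (f₂ ⊗ₘ f₃)) := by
  ext
  rw [comp_hom, comp_hom]
  rcases grade_eq_or_eq_zero f₁ with h1 | h1
  swap
  · rw [tensorHom_hom_zero_left _ _ (tensorHom_hom_zero_left _ _ h1),
      tensorHom_hom_zero_left _ _ h1]; simp
  rcases grade_eq_or_eq_zero f₂ with h2 | h2
  swap
  · rw [tensorHom_hom_zero_left _ _ (tensorHom_hom_zero_right _ _ h2),
      tensorHom_hom_zero_right _ _ (tensorHom_hom_zero_left _ _ h2)]; simp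
  rcases grade_eq_or_eq_zero f₃ with h3 | h3
  swap
  · rw [tensorHom_hom_zero_right _ _ h3,
      tensorHom_hom_zero_right _ _ (tensorHom_hom_zero_right _ _ h3)]; simp
  obtain ⟨a, X₁, hX₁⟩ := X₁
  obtain ⟨b, X₂, hX₂⟩ := X₂
  obtain ⟨c, X₃, hX₃⟩ := X₃
  obtain ⟨_, Y₁, hY₁⟩ := Y₁
  obtain ⟨_, Y₂, hY₂⟩ := Y₂
  obtain ⟨_, Y₃, hY₃⟩ := Y₃
  dsimp only at h1 h2 h3
  subst h1 h2 h3
  simpa [tensorHom_hom, tensorObj_grade, associator_def] using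
    asc_nat f₁.hom f₂.hom f₃.hom (Z.assoc a b c)

lemma pentagon' (W X Y V : Zested Z) : ((α_ W X Y).hom ⊗ₘ 𝟙 V) ≫ (α_ W (X ⊗ Y) V).hom ≫
    (𝟙 W ⊗ₘ (α_ X Y V).hom) = (α_ (W ⊗ X) Y V).hom ≫ (α_ W X (Y ⊗ V)).hom := by
  obtain ⟨a, X₁, hX₁⟩ := W
  obtain ⟨b, X₂, hX₂⟩ := X
  obtain ⟨c, X₃, hX₃⟩ := Y
  obtain ⟨d, X₄, hX₄⟩ := V
  ext
  have := pent X₁ X₂ X₃ X₄ _ _ _ _ _ _ _ (Z.associative_condition a b c d)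
  simp only [comp_hom, tensorHom_hom, associator_def, mkIso_hom_hom, id_hom, tensorObj_grade,
    lamMap_eq Z.lam (mul_assoc a b c) (rfl : d = d),
    lamMap_eq Z.lam (rfl : a = a) (mul_assoc b c d)]
  rw [tensorHom_id, id_tensorHom]
  exact this

lemma triangle' (X Y : Zested Z) : (α_ X (𝟙_ _) Y).hom ≫ (𝟙 X ⊗ₘ (λ_ Y).hom) =
    (ρ_ X).hom ⊗ₘ 𝟙 Y := by
  obtain ⟨a, X, hX⟩ := X
  obtain ⟨b, Y, hY⟩ := Y
  ext
  have := tri X Y _ _ _ _ _ (Z.normalized a b)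
  simp only [comp_hom, tensorHom_hom, associator_def, leftUnitor_def, rightUnitor_def,
    mkIso_hom_hom, id_hom, tensorObj_grade, tensorUnit_grade,
    lamMap_eq Z.lam (rfl : a = a) (one_mul b), lamMap_eq Z.lam (mul_one a) (rfl : b = b),
    Iso.trans_hom, tensorIso_hom]
  rw [tensorHom_id, id_tensorHom]
  exact this

lemma leftUnitor_naturality' {X Y : Zested Z} (f : X ⟶ Y) :
    (𝟙 (𝟙_ _) ⊗ₘ f) ≫ (λ_ Y).hom = (λ_ X).hom ≫ f := by
  ext
  rw [comp_hom, comp_hom]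
  rcases grade_eq_or_eq_zero f with h1 | h1
  swap
  · rw [tensorHom_hom_zero_right _ _ h1, h1]; simp
  obtain ⟨a, X, hX⟩ := X
  obtain ⟨_, Y, hY⟩ := Y
  dsimp only at h1
  subst h1
  rw [tensorHom_hom, lamMap_self]
  exact leftUnit_nat f.hom (Z.unitL a).hom

lemma rightUnitor_naturality' {X Y : Zested Z} (f : X ⟶ Y) :
    (f ⊗ₘ 𝟙 (𝟙_ _)) ≫ (ρ_ Y).hom = (ρ_ X).hom ≫ f := by
  ext
  rw [comp_hom, comp_hom]
  rcases grade_eq_or_eq_zero f with h1 | h1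
  swap
  · rw [tensorHom_hom_zero_left _ _ h1, h1]; simp
  obtain ⟨a, X, hX⟩ := X
  obtain ⟨_, Y, hY⟩ := Y
  dsimp only at h1
  subst h1
  rw [tensorHom_hom, lamMap_self]
  exact rightUnit_nat f.hom (Z.unitR a).hom

noncomputable instance : MonoidalCategory (Zested Z) := MonoidalCategory.ofTensorHom
  (id_tensorHom_id := id_tensorHom_id')
  (id_tensorHom := fun _ _ _ _ => rfl)
  (tensorHom_id := fun _ _ => rfl)
  (tensorHom_comp_tensorHom := tensorHom_comp')
  (associator_naturality := associator_naturality')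
  (leftUnitor_naturality := leftUnitor_naturality')
  (rightUnitor_naturality := rightUnitor_naturality')
  (pentagon := pentagon')
  (triangle := triangle')

/-- The zested braiding `c'_{X,Y} = c_{X,Y} ⊗ t(a,b)`. -/
noncomputable instance : BraidedCategory (Zested Z) where
  braiding X Y := mkIso (β_ X.obj Y.obj ⊗ᵢ Z.t X.grade Y.grade)
  braiding_naturality_right X Y Y' g := by
    ext
    rw [comp_hom, comp_hom]
    rw [← tensorHom_id, ← id_tensorHom]
    rcases grade_eq_or_eq_zero g with h1 | h1
    swap
    · rw [tensorHom_hom_zero_right _ _ h1, tensorHom_hom_zero_left _ _ h1]; simp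
    obtain ⟨a, X, hX⟩ := X
    obtain ⟨b, Y, hY⟩ := Y
    obtain ⟨_, Y', hY'⟩ := Y'
    dsimp only at h1
    subst h1
    rw [tensorHom_hom, tensorHom_hom, lamMap_self, lamMap_self]
    exact braid_nat_right X g.hom _
  braiding_naturality_left {X X'} f Y := by
    ext
    rw [comp_hom, comp_hom]
    rw [← tensorHom_id, ← id_tensorHom]
    rcases grade_eq_or_eq_zero f with h1 | h1
    swap
    · rw [tensorHom_hom_zero_right _ _ h1, tensorHom_hom_zero_left _ _ h1]; simp
    obtain ⟨a, X, hX⟩ := X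
    obtain ⟨b, Y, hY⟩ := Y
    obtain ⟨_, X', hX'⟩ := X'
    dsimp only at h1
    subst h1
    rw [tensorHom_hom, tensorHom_hom, lamMap_self, lamMap_self]
    exact braid_nat_left f.hom Y _
  hexagon_forward X Y W := by
    obtain ⟨a, X, hX⟩ := X
    obtain ⟨b, Y, hY⟩ := Y
    obtain ⟨c, W, hW⟩ := W
    ext
    have := hexF X Y W _ _ _ _ _ _ _ _ (Z.braided_condition₁ a b c)
    simp only [comp_hom, whiskerLeft_hom, whiskerRight_hom, associator_def, mkIso_hom_hom,
      tensorObj_grade, lamMap_eq Z.lam (mul_comm a b) (rfl : c = c),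
      lamMap_eq Z.lam (rfl : b = b) (mul_comm a c), tensorIso_hom]
    rw [tensorHom_id, id_tensorHom]
    exact this
  hexagon_reverse X Y W := by
    obtain ⟨a, X, hX⟩ := X
    obtain ⟨b, Y, hY⟩ := Y
    obtain ⟨c, W, hW⟩ := W
    ext
    obtain ⟨ω, hω, h⟩ := Z.braided_condition₂ a b c
    have := hexR X Y W _ _ _ _ _ _ _ _ ω (hω W hW) h
    simp only [comp_hom, whiskerLeft_hom, whiskerRight_hom, associator_def, mkIso_hom_hom,
      mkIso_inv_hom, tensorObj_grade, lamMap_eq Z.lam (mul_comm a c) (rfl : b = b),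
      lamMap_eq Z.lam (rfl : a = a) (mul_comm b c), tensorIso_hom]
    rw [tensorHom_id, id_tensorHom]
    exact this

lemma braiding_def (X Y : Zested Z) : β_ X Y = mkIso (β_ X.obj Y.obj ⊗ᵢ Z.t X.grade Y.grade) := rfl

end Zested

section Snake

variable {D : Type u} [Category.{v} D] [MonoidalCategory D]

lemma snake_idem {X Y : D} (c : 𝟙_ D ⟶ X ⊗ Y) (e : Y ⊗ X ⟶ 𝟙_ D)
    (h : c ▷ X ≫ (α_ _ _ _).hom ≫ X ◁ e = (λ_ X).hom ≫ (ρ_ X).inv) :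
    (𝟙 Y ⊗≫ Y ◁ c ⊗≫ e ▷ Y ⊗≫ 𝟙 Y) ≫ (𝟙 Y ⊗≫ Y ◁ c ⊗≫ e ▷ Y ⊗≫ 𝟙 Y) =
      𝟙 Y ⊗≫ Y ◁ c ⊗≫ e ▷ Y ⊗≫ 𝟙 Y := by
  calc
    _ = 𝟙 Y ⊗≫ Y ◁ c ⊗≫ (e ▷ Y ≫ 𝟙_ D ◁ (𝟙 Y ⊗≫ Y ◁ c)) ⊗≫ e ▷ Y ⊗≫ 𝟙 Y := by monoidal
    _ = 𝟙 Y ⊗≫ Y ◁ (c ▷ 𝟙_ D ≫ (X ⊗ Y) ◁ c) ⊗≫ (e ▷ (Y ⊗ X) ≫ 𝟙_ D ◁ e) ▷ Y ⊗≫ 𝟙 Y := by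
      rw [← whisker_exchange]; monoidal
    _ = 𝟙 Y ⊗≫ Y ◁ c ⊗≫ Y ◁ (c ▷ X ≫ (α_ _ _ _).hom ≫ X ◁ e) ▷ Y ⊗≫ e ▷ Y ⊗≫ 𝟙 Y := by
      rw [← whisker_exchange, ← whisker_exchange]; monoidal
    _ = _ := by
      rw [h]; monoidal

/-- If the first zigzag composite is the identity and the second one is invertible, then both
are identities. -/
lemma snake_second {X Y : D} (c : 𝟙_ D ⟶ X ⊗ Y) (e : Y ⊗ X ⟶ 𝟙_ D)
    (h : c ▷ X ≫ (α_ _ _ _).hom ≫ X ◁ e = (λ_ X).hom ≫ (ρ_ X).inv)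
    (hi : IsIso (Y ◁ c ≫ (α_ _ _ _).inv ≫ e ▷ Y)) :
    Y ◁ c ≫ (α_ _ _ _).inv ≫ e ▷ Y = (ρ_ Y).hom ≫ (λ_ Y).inv := by
  have h1 := snake_idem c e h
  have h2 : (𝟙 Y ⊗≫ Y ◁ c ⊗≫ e ▷ Y ⊗≫ 𝟙 Y) =
      (ρ_ Y).inv ≫ (Y ◁ c ≫ (α_ _ _ _).inv ≫ e ▷ Y) ≫ (λ_ Y).hom := by monoidal
  rw [h2] at h1
  have h3 : (ρ_ Y).inv ≫ (Y ◁ c ≫ (α_ _ _ _).inv ≫ e ▷ Y) ≫ (λ_ Y).hom = 𝟙 Y := by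
    rw [← cancel_epi ((ρ_ Y).inv ≫ (Y ◁ c ≫ (α_ _ _ _).inv ≫ e ▷ Y) ≫ (λ_ Y).hom), h1,
      Category.comp_id]
  rw [Iso.inv_comp_eq, Category.comp_id, ← Iso.eq_comp_inv] at h3
  exact h3

end Snake

section DualGrade

variable {D : Type u} [Category.{v} D] [Abelian D] [MonoidalCategory D] [MonoidalPreadditive D]
  [RightRigidCategory D] {B : Type*} [CommGroup B]

lemma Grading.zero_mem (G : Grading B D) (a : B) {X : D} (hX : 𝟙 X = 0) : G.comp a X := by
  have h : G.comp a (⨁ (fun i : Fin 0 => i.elim0 : Fin 0 → D)) :=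
    G.biproduct_mem _ (fun i => i.elim0)
  refine G.of_iso ⟨0, 0, ?_, ?_⟩ h
  · exact biproduct.hom_ext _ _ (fun i => i.elim0)
  · rw [hX]; simp

/-- The dual of an object of `C_a` lies in `C_{a⁻¹}`. -/
lemma Grading.dual_mem (G : Grading B D) {a : B} {X : D} (hX : G.comp a X) :
    G.comp a⁻¹ (Xᘁ) := by
  obtain ⟨n, g, Y, hY, ⟨i⟩⟩ := G.decomposition (Xᘁ)
  refine G.of_iso i.symm (G.biproduct_mem Y fun j => ?_)
  by_cases h : g j = a⁻¹
  · exact h ▸ hY j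
  refine G.zero_mem _ ?_
  have h0 : ∀ f : Y j ⟶ Xᘁ, f = 0 := by
    intro f
    have h1 : f ▷ X ≫ ε_ X Xᘁ = 0 :=
      G.hom_eq_zero (G.tensor_mem (hY j) hX) G.unit_mem
        (fun h2 => h (eq_inv_of_mul_eq_one_left h2)) _
    have h2 : f = 𝟙 _ ⊗≫ Y j ◁ η_ X Xᘁ ⊗≫ (f ▷ X ≫ ε_ X Xᘁ) ▷ Xᘁ ⊗≫ 𝟙 _ := by
      calc
        f = f ⊗≫ (Xᘁ ◁ η_ X Xᘁ ⊗≫ ε_ X Xᘁ ▷ Xᘁ) ⊗≫ 𝟙 _ := by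
          rw [ExactPairing.coevaluation_evaluation'']; monoidal
        _ = 𝟙 _ ⊗≫ (f ▷ 𝟙_ D ≫ Xᘁ ◁ η_ X Xᘁ) ⊗≫ ε_ X Xᘁ ▷ Xᘁ ⊗≫ 𝟙 _ := by monoidal
        _ = _ := by rw [← whisker_exchange]; monoidal
    rw [h2, h1]
    simp [monoidalComp]
  have h3 : biproduct.ι Y j ≫ i.inv = 0 := h0 _
  calc 𝟙 (Y j) = (biproduct.ι Y j ≫ i.inv) ≫ i.hom ≫ biproduct.π Y j := by simp
    _ = 0 := by rw [h3, zero_comp]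

end DualGrade

namespace Zested

variable {Z : RibbonZesting k G}

/-- A chosen inverse of `λ(a, a⁻¹)`. -/
noncomputable def lamInv (Z : RibbonZesting k G) (a : A) : C :=
  (Z.lam_invertible a a⁻¹).choose

lemma lamInv_mem (Z : RibbonZesting k G) (a : A) : G.comp 1 (lamInv Z a) :=
  (Z.lam_invertible a a⁻¹).choose_spec.1

/-- `𝟙 ≅ λ(a, a⁻¹)⁻¹ ⊗ λ(a, a⁻¹)` -/
noncomputable def lamInvIso (Z : RibbonZesting k G) (a : A) :
    𝟙_ C ≅ lamInv Z a ⊗ Z.lam a a⁻¹ :=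
  (Z.lam_invertible a a⁻¹).choose_spec.2.some.symm ≪≫ β_ _ _

/-- The isomorphism `λ(a, a⁻¹) ≅ λ(a⁻¹, a)` given by `λ_{a,a⁻¹,a}`. -/
noncomputable def lamFlip (Z : RibbonZesting k G) (a : A) : Z.lam a a⁻¹ ≅ Z.lam a⁻¹ a :=
  (ρ_ _).symm ≪≫ whiskerLeftIso _ ((Z.unitL a).symm ≪≫ lamCast Z.lam (mul_inv_cancel a).symm rfl) ≪≫
    Z.assoc a a⁻¹ a ≪≫ whiskerLeftIso _ (lamCast Z.lam rfl (inv_mul_cancel a) ≪≫ Z.unitR a) ≪≫ ρ_ _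

lemma lamFlip_spec (Z : RibbonZesting k G) (a : A) :
    Z.lam a a⁻¹ ◁ (lamCast Z.lam (mul_inv_cancel a).symm rfl).hom ≫ (Z.assoc a a⁻¹ a).hom ≫
      Z.lam a⁻¹ a ◁ (lamCast Z.lam rfl (inv_mul_cancel a)).hom =
    Z.lam a a⁻¹ ◁ (Z.unitL a).hom ≫ (lamFlip Z a).hom ▷ 𝟙_ C ≫ Z.lam a⁻¹ a ◁ (Z.unitR a).inv := by
  simp [lamFlip]

/-- The dual `X^* ⊗ λ(a, a⁻¹)⁻¹` of `X ∈ C_a` in the zested category. -/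
noncomputable def dual (X : Zested Z) : Zested Z :=
  ⟨X.grade⁻¹, X.objᘁ ⊗ lamInv Z X.grade, by
    simpa using G.tensor_mem (G.dual_mem X.mem) (lamInv_mem Z X.grade)⟩

/-- The zested coevaluation. -/
noncomputable def coevZ (X : Zested Z) : 𝟙_ (Zested Z) ⟶ X ⊗ dual X :=
  ⟨coevRaw X.obj X.objᘁ (lamInvIso Z X.grade)⟩

/-- The zested evaluation. -/
noncomputable def evZ (X : Zested Z) : dual X ⊗ X ⟶ 𝟙_ (Zested Z) :=
  ⟨evRaw X.obj X.objᘁ (whiskerLeftIso _ (lamFlip Z X.grade).symm ≪≫ (lamInvIso Z X.grade).symm)⟩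

lemma isIso_of_hom {X Y : Zested Z} (f : X ⟶ Y) (h : IsIso f.hom) : IsIso f :=
  ⟨⟨⟨inv f.hom⟩, hom_ext (IsIso.hom_inv_id f.hom), hom_ext (IsIso.inv_hom_id f.hom)⟩⟩

lemma zigzag₁ (X : Zested Z) :
    coevZ X ▷ X ≫ (α_ X (dual X) X).hom ≫ X ◁ evZ X = (λ_ X).hom ≫ (ρ_ X).inv := by
  obtain ⟨a, X, hX⟩ := X
  ext
  have := zig1 (X := X) (Xd := Xᘁ) (lamInvIso Z a) (lamFlip Z a) (Z.assoc a a⁻¹ a) _ _ (Z.unitL a)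
    (Z.unitR a) (lamFlip_spec Z a)
  rw [comp_hom, comp_hom, whiskerLeft_hom, whiskerRight_hom, tensorHom_id, id_tensorHom]
  simp only [dual, tensorObj_grade, tensorUnit_grade,
    lamMap_eq Z.lam (mul_inv_cancel a).symm (rfl : a = a),
    lamMap_eq Z.lam (rfl : a = a) (inv_mul_cancel a)]
  exact this

lemma zigzag₂ (X : Zested Z) :
    dual X ◁ coevZ X ≫ (α_ (dual X) X (dual X)).inv ≫ evZ X ▷ dual X =
      (ρ_ (dual X)).hom ≫ (λ_ (dual X)).inv := by
  refine snake_second _ _ (zigzag₁ X) ?_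
  obtain ⟨a, X, hX⟩ := X
  have hi := zig2 (X := X) (Xd := Xᘁ) (lamInvIso Z a)
    (whiskerLeftIso _ (lamFlip Z a).symm ≪≫ (lamInvIso Z a).symm) (Z.assoc a⁻¹ a a⁻¹)
    (lamCast Z.lam (rfl : a⁻¹ = a⁻¹) (mul_inv_cancel a).symm)
    (lamCast Z.lam (inv_mul_cancel a) (rfl : a⁻¹ = a⁻¹))
  have h : (dual ⟨a, X, hX⟩ ◁ coevZ (Z := Z) ⟨a, X, hX⟩ ≫ (α_ (dual ⟨a, X, hX⟩) ⟨a, X, hX⟩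
      (dual ⟨a, X, hX⟩)).inv ≫ evZ ⟨a, X, hX⟩ ▷ dual ⟨a, X, hX⟩).hom =
      (((Xᘁ ⊗ lamInv Z a) ◁ coevRaw X Xᘁ (lamInvIso Z a) ⊗ₘ
        (lamCast Z.lam (rfl : a⁻¹ = a⁻¹) (mul_inv_cancel a).symm).hom) ≫
        (asc (Xᘁ ⊗ lamInv Z a) X (Xᘁ ⊗ lamInv Z a) (Z.assoc a⁻¹ a a⁻¹)).inv ≫
        (evRaw X Xᘁ (whiskerLeftIso _ (lamFlip Z a).symm ≪≫ (lamInvIso Z a).symm) ▷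
          (Xᘁ ⊗ lamInv Z a) ⊗ₘ
        (lamCast Z.lam (inv_mul_cancel a) (rfl : a⁻¹ = a⁻¹)).hom)) := by
    rw [comp_hom, comp_hom, whiskerLeft_hom, whiskerRight_hom, tensorHom_id, id_tensorHom]
    simp only [dual, tensorObj_grade, tensorUnit_grade,
      lamMap_eq Z.lam (rfl : a⁻¹ = a⁻¹) (mul_inv_cancel a).symm,
      lamMap_eq Z.lam (inv_mul_cancel a) (rfl : a⁻¹ = a⁻¹)]
    rfl
  rw [← h] at hi
  exact isIso_of_hom _ hi

noncomputable instance (X : Zested Z) : ExactPairing X (dual X) where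
  coevaluation' := coevZ X
  evaluation' := evZ X
  coevaluation_evaluation' := zigzag₂ X
  evaluation_coevaluation' := zigzag₁ X

noncomputable instance : RightRigidCategory (Zested Z) where
  rightDual X := { rightDual := dual X }

end Zested

section TwistLemmas

lemma smul_tensorHom (s : k) {X X' Y Y' : C} (f : X ⟶ X') (g : Y ⟶ Y') :
    (s • f) ⊗ₘ g = s • (f ⊗ₘ g) := by
  simp [MonoidalCategory.tensorHom_def]

lemma tensorHom_smul (s : k) {X X' Y Y' : C} (f : X ⟶ X') (g : Y ⟶ Y') :
    f ⊗ₘ (s • g) = s • (f ⊗ₘ g) := by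
  simp [MonoidalCategory.tensorHom_def]

lemma Grading.HasMonodromy.of_iso {p q : C} {c : A} {s : k} (h : G.HasMonodromy p c s)
    (e : p ≅ q) : G.HasMonodromy q c s := by
  intro X hX
  have h1 : (β_ X q).hom ≫ (β_ q X).hom = X ◁ e.inv ≫ ((β_ X p).hom ≫ (β_ p X).hom) ≫ X ◁ e.hom := by
    simp
  rw [h1, h X hX]
  simp [← MonoidalCategory.whiskerLeft_comp]

lemma Grading.HasMonodromy.twist_tensor {p : C} {c : A} {s : k} (h : G.HasMonodromy p c s) {X : C}
    (hX : G.comp c X) : (RibbonCategory.twist (X ⊗ p)).hom =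
      s • ((RibbonCategory.twist X).hom ⊗ₘ (RibbonCategory.twist p).hom) := by
  rw [RibbonCategory.twist_tensor, h X hX]
  simp

variable {D : Type u} [Category.{v} D] [MonoidalCategory D]

lemma rightAdjointMate_unique [RightRigidCategory D] {X : D} (f : X ⟶ X) (g : Xᘁ ⟶ Xᘁ)
    (h : g ▷ X ≫ ε_ X Xᘁ = Xᘁ ◁ f ≫ ε_ X Xᘁ) : fᘁ = g := by
  rw [← rightAdjointMate_comp_evaluation] at h
  have h1 := congrArg (tensorRightHomEquiv _ X Xᘁ _) h
  rw [tensorRightHomEquiv_whiskerRight_comp_evaluation,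
    tensorRightHomEquiv_whiskerRight_comp_evaluation, cancel_mono] at h1
  exact h1.symm

lemma twist_pairing [BraidedCategory D] [RightRigidCategory D] [RibbonCategory D] {Y W : D}
    (e : Y ⊗ W ⟶ 𝟙_ D) :
    (RibbonCategory.twist Y).hom ▷ W ≫ e = Y ◁ (RibbonCategory.twist W).hom ≫ e := by
  obtain ⟨g, rfl⟩ : ∃ g : Y ⟶ Wᘁ, e = g ▷ W ≫ ε_ W Wᘁ := by
    refine ⟨tensorRightHomEquiv _ W Wᘁ _ e ≫ (λ_ _).hom, ?_⟩
    apply (tensorRightHomEquiv _ W Wᘁ _).injective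
    rw [tensorRightHomEquiv_whiskerRight_comp_evaluation]
    simp
  rw [whisker_exchange_assoc, ← rightAdjointMate_comp_evaluation, RibbonCategory.twist_dual,
    ← comp_whiskerRight_assoc, ← RibbonCategory.twist_naturality, comp_whiskerRight_assoc]

end TwistLemmas

namespace Zested

variable {Z : RibbonZesting k G}

/-- The zested twist `θ'_X = f(a) θ_X` for `X ∈ C_a`. -/
noncomputable def zTwist (X : Zested Z) : X ≅ X := mkIso
  { hom := (Z.f X.grade : k) • (RibbonCategory.twist X.obj).hom
    inv := ((Z.f X.grade)⁻¹ : k) • (RibbonCategory.twist X.obj).inv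
    hom_inv_id := by simp [smul_smul]
    inv_hom_id := by simp [smul_smul] }

lemma zTwist_hom (X : Zested Z) :
    (zTwist X).hom.hom = (Z.f X.grade : k) • (RibbonCategory.twist X.obj).hom := rfl

lemma zTwist_naturality {X Y : Zested Z} (g : X ⟶ Y) : g ≫ (zTwist Y).hom = (zTwist X).hom ≫ g := by
  ext
  rw [comp_hom, comp_hom, zTwist_hom, zTwist_hom]
  rcases grade_eq_or_eq_zero g with h | h
  · rw [h]; simp [RibbonCategory.twist_naturality]
  · rw [h]; simp

lemma zTwist_tensor (X Y : Zested Z) : (zTwist (X ⊗ Y)).hom =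
    ((zTwist X).hom ⊗ₘ (zTwist Y).hom) ≫ (β_ X Y).hom ≫ (β_ Y X).hom := by
  obtain ⟨a, X, hX⟩ := X
  obtain ⟨b, Y, hY⟩ := Y
  ext
  obtain ⟨χ, h1, h2⟩ := Z.twist_condition a b
  rw [comp_hom, comp_hom, tensorHom_hom, lamMap_self, zTwist_hom, zTwist_hom, zTwist_hom]
  have h3 : (Z.f (a * b) : k) • (RibbonCategory.twist ((X ⊗ Y) ⊗ Z.lam a b)).hom =
      (((Z.f a : k) • (RibbonCategory.twist X).hom ⊗ₘ (Z.f b : k) • (RibbonCategory.twist Y).hom) ⊗ₘ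
        𝟙 (Z.lam a b)) ≫ ((β_ X Y).hom ⊗ₘ (Z.t a b).hom) ≫ ((β_ Y X).hom ⊗ₘ (Z.t b a).hom) := by
    rw [h1.twist_tensor (G.tensor_mem hX hY), smul_smul, ← tensorHom_smul, h2,
      RibbonCategory.twist_tensor]
    simp only [smul_tensorHom, tensorHom_smul, smul_smul, tensorHom_comp_tensorHom,
      Linear.smul_comp, Category.id_comp]
    rw [mul_comm (Z.f b : k)]
  exact h3

lemma ev_twist_raw {X Xd b q : C} [ExactPairing X Xd] (κ : b ⊗ q ≅ 𝟙_ C) {a : A}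
    (hX : G.comp a X) {s r r' : k} (hq : G.HasMonodromy q a s)
    (h : r • 𝟙 q = (r' * s) • (RibbonCategory.twist q).hom) :
    (r' • (RibbonCategory.twist (Xd ⊗ b)).hom) ▷ X ▷ q ≫ evRaw X Xd κ =
      ((Xd ⊗ b) ◁ (r • (RibbonCategory.twist X).hom)) ▷ q ≫ evRaw X Xd κ := by
  have h1 := twist_pairing ((α_ (Xd ⊗ b) X q).inv ≫ evRaw X Xd κ)
  rw [hq.twist_tensor hX] at h1
  have h2 : (RibbonCategory.twist (Xd ⊗ b)).hom ▷ X ▷ q ≫ evRaw X Xd κ = (α_ (Xd ⊗ b) X q).hom ≫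
      (RibbonCategory.twist (Xd ⊗ b)).hom ▷ (X ⊗ q) ≫ (α_ (Xd ⊗ b) X q).inv ≫ evRaw X Xd κ := by
    simp
  calc
    _ = r' • ((RibbonCategory.twist (Xd ⊗ b)).hom ▷ X ▷ q ≫ evRaw X Xd κ) := by simp
    _ = (α_ (Xd ⊗ b) X q).hom ≫ (Xd ⊗ b) ◁ ((RibbonCategory.twist X).hom ⊗ₘ
        ((r' * s) • (RibbonCategory.twist q).hom)) ≫ (α_ (Xd ⊗ b) X q).inv ≫ evRaw X Xd κ := by
      rw [h2, h1, tensorHom_smul]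
      simp [smul_smul]
    _ = _ := by
      rw [← h, tensorHom_smul]
      simp

lemma zTwist_dual (X : Zested Z) : ((zTwist X).hom)ᘁ = (zTwist Xᘁ).hom := by
  apply rightAdjointMate_unique
  obtain ⟨a, X, hX⟩ := X
  ext
  obtain ⟨χ, h1, h2⟩ := Z.ribbon_condition a
  have h3 : (Z.f a : k) • 𝟙 (Z.lam a⁻¹ a) =
      ((Z.f a⁻¹ : k) * χ) • (RibbonCategory.twist (Z.lam a⁻¹ a)).hom := by
    rw [← cancel_epi (lamFlip Z a).hom, Linear.comp_smul, Linear.comp_smul,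
      RibbonCategory.twist_naturality, ← Linear.smul_comp (R := k) _ _ _ _ (RibbonCategory.twist _).hom, ← h2]
    simp
  have := ev_twist_raw (Xd := Xᘁ)
    (whiskerLeftIso (lamInv Z a) (lamFlip Z a).symm ≪≫ (lamInvIso Z a).symm) hX
    (h1.of_iso (lamFlip Z a)) h3
  rw [comp_hom, comp_hom, whiskerLeft_hom, whiskerRight_hom, lamMap_self,
    tensorHom_id, tensorHom_id, tensorHom_id, id_tensorHom, zTwist_hom, zTwist_hom]
  exact this

noncomputable instance : RibbonCategory (Zested Z) where
  twist := zTwist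
  twist_naturality := zTwist_naturality
  twist_tensor := zTwist_tensor
  twist_dual := zTwist_dual

end Zested

end ZestedCategory

end Zesting

/-! Zesting alters a diagram only through invertible objects attached to its strands, and these can
be pulled away from the colours. In the zested category a row of strands is the ordinary row
tensored with one invertible object, `strandsLam`, determined by the grades (`splitIso`). A zested
crossing is the ordinary crossing tensored with some `t(a,b)`, conjugated by zested associators.
Those associators braid `λ(a,b)` with the rest of the row, but the half braiding used on the way in
is undone on the way out (`asc_conj`). So after splitting, a crossing acts as (ordinary crossing) ⊗
(isomorphism of invertible objects), the second factor depending only on the zesting and the grades;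
composing gives `BraidWord.eval_zested` for the whole braid.

Closing the braid gives three scalars. The zested trace differs from the trace in `C` by `f(a)`,
with `a` the total grade of the row, and by a closed loop `lamLoop` of `λ(a,a⁻¹)`; again the half
braidings in the zested braiding and evaluation cancel (`raw_trace`, `trace_hom`). What remains is
the ordinary trace of `f ⊗ g`, with `g` an automorphism of an invertible object. By Schur's lemma
`g` is a nonzero scalar, and the loop coloured by the invertible object is a nonzero scalar too,
because coevaluation and evaluation of an invertible object are isomorphisms
(`exists_trace_tensor`). The product of the three scalars never sees the colours beyond their
grades. -/

namespace Zesting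

/-! ### Cyclicity of the ribbon trace and its behaviour on tensor products -/

section Trace

/-- The adjoint mate taken with respect to arbitrary dual pairs, so that duals such as `Q ⊗ Y` of `X
⊗ P` can be used in place of the one chosen by rigidity. -/
lemma exists_mate {D : Type u} [Category.{v} D] [MonoidalCategory D] {X X' Y Y' : D}
    [ExactPairing X Y] [ExactPairing X' Y'] (f : X ⟶ X') :
    ∃ m : Y' ⟶ Y, η_ X' Y' ≫ X' ◁ m = η_ X Y ≫ f ▷ Y ∧ m ▷ X ≫ ε_ X Y = Y' ◁ f ≫ ε_ X' Y' := by
  let _ : HasRightDual X := ⟨Y⟩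
  let _ : HasRightDual X' := ⟨Y'⟩
  exact ⟨fᘁ, coevaluation_comp_rightAdjointMate f, rightAdjointMate_comp_evaluation f⟩

variable {C : Type u} [Category.{v} C] [MonoidalCategory C] [BraidedCategory C]
  [RightRigidCategory C] [RibbonCategory C]

/-- The pairing `X ⊗ Y ⟶ 𝟙_ C` obtained from the evaluation `Y ⊗ X ⟶ 𝟙_ C`, the braiding and the
twist. -/
def rightEv (X Y : C) [ExactPairing X Y] : X ⊗ Y ⟶ 𝟙_ C :=
  (RibbonCategory.twist X).hom ▷ Y ≫ (β_ X Y).hom ≫ ε_ X Y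

/-- The categorical trace computed with an arbitrary right dual. -/
def pairingTrace {X : C} (Y : C) [ExactPairing X Y] (f : X ⟶ X) : 𝟙_ C ⟶ 𝟙_ C :=
  η_ X Y ≫ f ▷ Y ≫ rightEv X Y

lemma trace_eq_pairingTrace {X : C} (f : X ⟶ X) : trace f = pairingTrace Xᘁ f := by
  simp [trace, pairingTrace, rightEv]

/-- The morphism `f` travels once around the loop through its mate. Since the two sides may use
unrelated duals, the case of an identity `g` also shows that the trace does not depend on the dual.
-/
lemma pairingTrace_comp_comm {X X' Y Y' : C} [ExactPairing X Y] [ExactPairing X' Y'] (f : X ⟶ X')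
    (g : X' ⟶ X) : pairingTrace Y (f ≫ g) = pairingTrace Y' (g ≫ f) := by
  obtain ⟨m, h1, h2⟩ := exists_mate (Y := Y) (Y' := Y') f
  simp only [pairingTrace, rightEv, comp_whiskerRight, Category.assoc]
  -- At the coevaluation `f` becomes `m` on the dual strand; there it passes `g`, the twist and the
  -- braiding, turns back into `f` at the evaluation, and naturality of braiding and twist puts it
  -- after `g`.
  rw [← reassoc_of% h1, whisker_exchange_assoc, whisker_exchange_assoc,
    BraidedCategory.braiding_naturality_right_assoc, h2,
    ← BraidedCategory.braiding_naturality_left_assoc, ← comp_whiskerRight_assoc (RibbonCategory.twist X).hom f,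
    ← RibbonCategory.twist_naturality, comp_whiskerRight_assoc]

lemma trace_eq_of_pairing {X : C} (Y : C) [ExactPairing X Y] (f : X ⟶ X) :
    trace f = pairingTrace Y f := by
  rw [trace_eq_pairingTrace]
  simpa using pairingTrace_comp_comm (Y := Xᘁ) (Y' := Y) f (𝟙 X)

lemma trace_conj {X X' : C} (e : X ≅ X') (f : X' ⟶ X') : trace (e.hom ≫ f ≫ e.inv) = trace f := by
  rw [trace_eq_pairingTrace, trace_eq_pairingTrace,
    pairingTrace_comp_comm (Y' := X'ᘁ) e.hom (f ≫ e.inv)]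
  simp

/-- Naturality of the braiding in `e`: a strand `P` slides across a cap, since braiding with the
unit is trivial. -/
lemma braiding_pairing_left (P : C) {X Y : C} (e : X ⊗ Y ⟶ 𝟙_ C) :
    (β_ P X).hom ▷ Y ⊗≫ X ◁ (β_ P Y).hom ⊗≫ e ▷ P = 𝟙 _ ⊗≫ P ◁ e ⊗≫ 𝟙 _ := by
  have h := BraidedCategory.braiding_naturality_right P e
  rw [BraidedCategory.braiding_tensor_right_hom, braiding_tensorUnit_right] at h
  calc
    _ = 𝟙 _ ⊗≫ (((α_ P X Y).inv ≫ (β_ P X).hom ▷ Y ≫ (α_ X P Y).hom ≫ X ◁ (β_ P Y).hom ≫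
      (α_ X Y P).inv) ≫ e ▷ P) ⊗≫ 𝟙 _ := by monoidal
    _ = _ := by
      rw [← h]; monoidal

/-- The double braiding in the twist of `X ⊗ P` is exactly what disentangles the two caps, leaving
the `P`-cap nested inside the `X`-cap. This is the monoidality of the pivotal structure underlying
the ribbon structure. -/
lemma rightEv_tensor (X Y P Q : C) [ExactPairing X Y] [ExactPairing P Q] :
    rightEv (X ⊗ P) (Q ⊗ Y) = 𝟙 _ ⊗≫ X ◁ rightEv P Q ▷ Y ⊗≫ rightEv X Y := by
  simp only [rightEv, RibbonCategory.twist_tensor, ExactPairing.tensor_evaluation,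
    BraidedCategory.braiding_tensor_left_hom, BraidedCategory.braiding_tensor_right_hom,
    MonoidalCategory.tensorHom_def]
  generalize (RibbonCategory.twist X).hom = u
  generalize (RibbonCategory.twist P).hom = w
  calc
    _ = 𝟙 _ ⊗≫ u ▷ (P ⊗ Q ⊗ Y) ⊗≫ X ◁ w ▷ (Q ⊗ Y) ⊗≫ (β_ X P).hom ▷ (Q ⊗ Y) ⊗≫
        ((α_ P X Q).inv ≫ (β_ P X).hom ▷ Q ≫ (α_ X P Q).hom ≫ X ◁ (β_ P Q).hom ≫
          (α_ X Q P).inv ≫ (β_ X Q).hom ▷ P ≫ (α_ Q X P).hom) ▷ Y ⊗≫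
        (Q ⊗ X) ◁ (β_ P Y).hom ⊗≫
        Q ◁ ((β_ X Y).hom ≫ ε_ X Y) ▷ P ⊗≫ ε_ P Q := by monoidal
    -- Yang–Baxter moves the second `X`–`P` crossing next to the cap on `X` and `Y`, so that `P` can
    -- slide across that cap.
    _ = 𝟙 _ ⊗≫ u ▷ (P ⊗ Q ⊗ Y) ⊗≫ X ◁ w ▷ (Q ⊗ Y) ⊗≫ (β_ X P).hom ▷ (Q ⊗ Y) ⊗≫
        P ◁ (β_ X Q).hom ▷ Y ⊗≫ (β_ P Q).hom ▷ (X ⊗ Y) ⊗≫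
        Q ◁ ((β_ P X).hom ▷ Y ⊗≫ X ◁ (β_ P Y).hom ⊗≫ ((β_ X Y).hom ≫ ε_ X Y) ▷ P) ⊗≫ ε_ P Q := by
      rw [BraidedCategory.yang_baxter]; monoidal
    _ = 𝟙 _ ⊗≫ u ▷ (P ⊗ Q ⊗ Y) ⊗≫ X ◁ w ▷ (Q ⊗ Y) ⊗≫ (β_ X P).hom ▷ (Q ⊗ Y) ⊗≫
        P ◁ (β_ X Q).hom ▷ Y ⊗≫ (β_ P Q).hom ▷ (X ⊗ Y) ⊗≫
        ((Q ⊗ P) ◁ ((β_ X Y).hom ≫ ε_ X Y) ≫ ε_ P Q ▷ 𝟙_ C) ⊗≫ 𝟙 _ := by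
      rw [braiding_pairing_left]; monoidal
    _ = 𝟙 _ ⊗≫ u ▷ (P ⊗ Q ⊗ Y) ⊗≫ X ◁ w ▷ (Q ⊗ Y) ⊗≫
        ((((α_ X P Q).inv ≫ (β_ X P).hom ▷ Q ≫ (α_ P X Q).hom ≫ P ◁ (β_ X Q).hom ≫
          (α_ P Q X).inv) ≫ ((β_ P Q).hom ≫ ε_ P Q) ▷ X) ▷ Y) ⊗≫
        ((β_ X Y).hom ≫ ε_ X Y) := by
      rw [whisker_exchange]; monoidal
    -- The remaining crossings are the braiding of `X` with `P ⊗ Q`, which disappears by naturality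
    -- with respect to the cap on `P` and `Q`.
    _ = 𝟙 _ ⊗≫ (u ▷ (P ⊗ Q) ≫ X ◁ (w ▷ Q ≫ (β_ P Q).hom ≫ ε_ P Q)) ▷ Y ⊗≫
        ((β_ X Y).hom ≫ ε_ X Y) := by
      rw [← BraidedCategory.braiding_tensor_right_hom,
        ← BraidedCategory.braiding_naturality_right, braiding_tensorUnit_right]
      monoidal
    _ = _ := by
      rw [← whisker_exchange]; monoidal

/-- With both cups and caps nested, the inner `P`-loop closes by itself. It is left inside the
`X`-loop, to be pulled out once it is known to be a scalar. -/
lemma pairingTrace_tensor {X P : C} (Y Q : C) [ExactPairing X Y] [ExactPairing P Q] (f : X ⟶ X) :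
    pairingTrace (Q ⊗ Y) (f ▷ P) =
      η_ X Y ≫ (f ▷ Y ⊗≫ X ◁ pairingTrace Q (𝟙 P) ▷ Y ⊗≫ rightEv X Y) := by
  simp only [pairingTrace]
  rw [rightEv_tensor, ExactPairing.tensor_coevaluation]
  calc
    _ = η_ X Y ⊗≫ (X ◁ (η_ P Q ▷ Y) ≫ f ▷ ((P ⊗ Q) ⊗ Y)) ⊗≫ X ◁ rightEv P Q ▷ Y ⊗≫ rightEv X Y := by
      monoidal
    _ = _ := by
      rw [whisker_exchange]; monoidal

end Trace

/-! ### Duality morphisms of invertible objects -/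

section Invertible

variable {C : Type u} [Category.{v} C] [MonoidalCategory C]

lemma tensorLeft_isEquivalence {P M : C} (e : P ⊗ M ≅ 𝟙_ C) (e' : M ⊗ P ≅ 𝟙_ C) :
    (tensorLeft P).IsEquivalence :=
  (CategoryTheory.Equivalence.mk (tensorLeft P) (tensorLeft M)
    ((leftUnitorNatIso C).symm ≪≫ (curriedTensor C).mapIso e'.symm ≪≫ tensorLeftTensor M P)
    ((tensorLeftTensor P M).symm ≪≫ (curriedTensor C).mapIso e ≪≫
      leftUnitorNatIso C)).isEquivalence_functor

/-- Duality makes `tensorLeft Q` left adjoint to `tensorLeft P`. As `P` is invertible this is an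
adjoint equivalence, and its unit at `𝟙_ C` is the coevaluation up to a unitor. The evaluation is
obtained likewise from the counit. -/
lemma isIso_coevaluation {P Q M : C} [ExactPairing P Q] (e : P ⊗ M ≅ 𝟙_ C)
    (e' : M ⊗ P ≅ 𝟙_ C) : IsIso (η_ P Q) := by
  have := tensorLeft_isEquivalence e e'
  have := (tensorLeftAdjunction P Q).isEquivalence_left_of_isEquivalence_right
  have h : IsIso ((tensorLeftAdjunction P Q).unit.app (𝟙_ C)) := inferInstance
  have h1 : (tensorLeftAdjunction P Q).unit.app (𝟙_ C) = η_ P Q ≫ P ◁ (ρ_ Q).inv := by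
    simp [tensorLeftAdjunction, tensorLeftHomEquiv]
    monoidal
  rw [h1] at h
  exact IsIso.of_isIso_comp_right _ (P ◁ (ρ_ Q).inv)

lemma isIso_evaluation {P Q M : C} [ExactPairing P Q] (e : P ⊗ M ≅ 𝟙_ C)
    (e' : M ⊗ P ≅ 𝟙_ C) : IsIso (ε_ P Q) := by
  have := tensorLeft_isEquivalence e e'
  have h : IsIso ((tensorLeftAdjunction P Q).counit.app (𝟙_ C)) := inferInstance
  have h1 : (tensorLeftAdjunction P Q).counit.app (𝟙_ C) = Q ◁ (ρ_ P).hom ≫ ε_ P Q := by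
    simp [tensorLeftAdjunction, tensorLeftHomEquiv]
    monoidal
  rw [h1] at h
  exact IsIso.of_isIso_comp_left (Q ◁ (ρ_ P).hom) _

end Invertible

/-! ### Schur's lemma and the loop values of invertible objects -/

section Scalars

variable {k : Type*} [Field k] [IsAlgClosed k] {C : Type u} [Category.{v} C] [Abelian C]
  [Linear k C] [MonoidalCategory C] [IsFusionCategory k C]

lemma exists_unit_smul_of_isIso (f : 𝟙_ C ⟶ 𝟙_ C) [IsIso f] : ∃ s : kˣ, f = (s : k) • 𝟙 (𝟙_ C) := by
  have := IsFusionCategory.simple_unit k (C := C)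
  have := IsFusionCategory.finite_hom (k := k) (𝟙_ C) (𝟙_ C)
  obtain ⟨s, rfl⟩ := endomorphism_simple_eq_smul_id k f
  have hs : s ≠ 0 := by
    rintro rfl
    rw [zero_smul] at *
    exact id_nonzero (𝟙_ C) ((isIsoZeroEquiv _ _).toFun ‹_›).1
  exact ⟨Units.mk0 s hs, rfl⟩

variable [MonoidalPreadditive C] [MonoidalLinear k C]

/-- Tensoring with the inverse `M` is faithful and carries `g` to an automorphism of an object
isomorphic to the unit, where Schur's lemma applies. -/
lemma exists_unit_smul_of_invertible {P M : C} (e : P ⊗ M ≅ 𝟙_ C) (e' : M ⊗ P ≅ 𝟙_ C)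
    (g : P ⟶ P) [IsIso g] : ∃ s : kˣ, g = (s : k) • 𝟙 P := by
  have := tensorLeft_isEquivalence e' e
  obtain ⟨s, hs⟩ := exists_unit_smul_of_isIso (k := k) (e'.inv ≫ M ◁ g ≫ e'.hom)
  refine ⟨s, (tensorLeft M).map_injective ?_⟩
  rw [Iso.inv_comp_eq, ← Iso.eq_comp_inv] at hs
  simp only [curriedTensor_obj_map, hs]
  simp

variable [BraidedCategory C] [RightRigidCategory C] [RibbonCategory C]

/-- Every factor of the loop (coevaluation, twist, braiding, evaluation) is invertible, so the
dimension of `P` cannot vanish. -/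
lemma exists_dimension {P M : C} (e : P ⊗ M ≅ 𝟙_ C) :
    ∃ d : kˣ, pairingTrace Pᘁ (𝟙 P) = (d : k) • 𝟙 (𝟙_ C) := by
  have := isIso_coevaluation (Q := Pᘁ) e (β_ M P ≪≫ e)
  have := isIso_evaluation (Q := Pᘁ) e (β_ M P ≪≫ e)
  have : IsIso (pairingTrace Pᘁ (𝟙 P)) := by
    unfold pairingTrace rightEv
    infer_instance
  exact exists_unit_smul_of_isIso _

/-- The scalar is fixed before `X` and `f`: it is the value of `g` times the dimension of `P`. This
uniformity is what makes the final factor independent of the colours. -/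
lemma exists_trace_tensor {P M : C} (e : P ⊗ M ≅ 𝟙_ C) (g : P ⟶ P) [IsIso g] :
    ∃ d : kˣ, ∀ (X : C) (f : X ⟶ X), trace (f ⊗ₘ g) = (d : k) • trace f := by
  obtain ⟨s, rfl⟩ := exists_unit_smul_of_invertible (k := k) e (β_ M P ≪≫ e) g
  obtain ⟨d, hd⟩ := exists_dimension (k := k) e
  refine ⟨s * d, fun X f => ?_⟩
  have h : trace (f ▷ P) = (d : k) • trace f := by
    -- The dual `Pᘁ ⊗ Xᘁ` replaces the chosen dual of `X ⊗ P`, because its cups and caps are nested.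
    rw [trace_eq_of_pairing (Pᘁ ⊗ Xᘁ), pairingTrace_tensor, hd, trace_eq_pairingTrace, pairingTrace]
    simp [monoidalComp]
  rw [tensorHom_smul, tensorHom_id, Units.val_mul, mul_smul, ← h]
  simp [trace]

end Scalars

/-! ### Exchanging two strands in front of a row -/

section Cores

variable {D : Type u} [Category.{v} D] [MonoidalCategory D]

/-- An exchange of the first two strands does not touch the rest of the row, so an identity proved
with `T` as the rest can be pulled back along `φ`. It is used with `φ` the splitting of the
remaining strands. -/
lemma exchange_naturality {X Y S T U V : D} (φ : S ⟶ T) (b : X ⊗ Y ⟶ Y ⊗ X)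
    (p : X ⊗ Y ⊗ T ⟶ U) (q : Y ⊗ X ⊗ T ⟶ V) (s : U ⟶ V)
    (h : ((α_ X Y T).inv ≫ b ▷ T ≫ (α_ Y X T).hom) ≫ q = p ≫ s) :
    ((α_ X Y S).inv ≫ b ▷ S ≫ (α_ Y X S).hom) ≫ Y ◁ X ◁ φ ≫ q = (X ◁ Y ◁ φ ≫ p) ≫ s := by
  rw [Category.assoc (X ◁ Y ◁ φ), ← h]
  simp only [Category.assoc]
  rw [← associator_naturality_right_assoc, associator_inv_naturality_right_assoc,
    whisker_exchange_assoc]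

variable [BraidedCategory D]

/-- Conjugating by the zested associator, the invertible object passes under the strand `W` and
back, so that the two half braidings cancel. -/
lemma asc_conj (X Y X' Y' W : D) {p q s u p' q' s' u' : D} (l : p ⊗ q ≅ s ⊗ u)
    (l' : p' ⊗ q' ≅ s' ⊗ u') (b : X ⊗ Y ⟶ X' ⊗ Y') (t : p ⟶ p') (ρ : q ⟶ q') :
    (asc X Y W l).inv ≫ (((b ⊗ₘ t) ▷ W) ⊗ₘ ρ) ≫ (asc X' Y' W l').hom =
      𝟙 _ ⊗≫ b ▷ (W ⊗ s ⊗ u) ⊗≫ (X' ⊗ Y' ⊗ W) ◁ (l.inv ≫ (t ⊗ₘ ρ) ≫ l'.hom) ⊗≫ 𝟙 _ := by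
  simp only [asc_hom, asc_inv, MonoidalCategory.tensorHom_def]
  calc
    _ = 𝟙 _ ⊗≫ (X ⊗ Y ⊗ W) ◁ l.inv ⊗≫ ((X ⊗ Y) ◁ (β_ W p).hom ≫ b ▷ (p ⊗ W)) ▷ q ⊗≫
        (X' ⊗ Y') ◁ (t ▷ W ▷ q ≫ (p' ⊗ W) ◁ ρ) ⊗≫
        (X' ⊗ Y') ◁ (β_ W p').inv ▷ q' ⊗≫ (X' ⊗ Y' ⊗ W) ◁ l'.hom ⊗≫ 𝟙 _ := by monoidal
    _ = 𝟙 _ ⊗≫ ((X ⊗ Y) ◁ (W ◁ l.inv) ≫ b ▷ (W ⊗ p ⊗ q)) ⊗≫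
        (X' ⊗ Y') ◁ (β_ W p).hom ▷ q ⊗≫ (X' ⊗ Y') ◁ ((p ⊗ W) ◁ ρ ≫ t ▷ W ▷ q' ≫
        (β_ W p').inv ▷ q') ⊗≫ (X' ⊗ Y' ⊗ W) ◁ l'.hom ⊗≫ 𝟙 _ := by
      rw [whisker_exchange, ← whisker_exchange (t ▷ W) ρ]; monoidal
    _ = 𝟙 _ ⊗≫ b ▷ (W ⊗ s ⊗ u) ⊗≫ (X' ⊗ Y' ⊗ W) ◁ l.inv ⊗≫
        (X' ⊗ Y') ◁ ((β_ W p).hom ▷ q ≫ (p ⊗ W) ◁ ρ) ⊗≫ (X' ⊗ Y') ◁ (t ▷ W ≫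
        (β_ W p').inv) ▷ q' ⊗≫ (X' ⊗ Y' ⊗ W) ◁ l'.hom ⊗≫ 𝟙 _ := by
      rw [whisker_exchange]; monoidal
    _ = 𝟙 _ ⊗≫ b ▷ (W ⊗ s ⊗ u) ⊗≫ (X' ⊗ Y' ⊗ W) ◁ l.inv ⊗≫
        (X' ⊗ Y' ⊗ W ⊗ p) ◁ ρ ⊗≫ (X' ⊗ Y') ◁ ((β_ W p).hom ≫ (β_ W p).inv) ▷ q' ⊗≫
        (X' ⊗ Y' ⊗ W) ◁ (t ▷ q') ⊗≫ (X' ⊗ Y' ⊗ W) ◁ l'.hom ⊗≫ 𝟙 _ := by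
      rw [← whisker_exchange, BraidedCategory.braiding_inv_naturality_left]; monoidal
    _ = _ := by
      rw [Iso.hom_inv_id, ← whisker_exchange t ρ]; monoidal

end Cores

/-! ### Splitting the invertible objects off a zested braid -/

section Split

variable {k : Type*} [Field k] {C : Type u} [Category.{v} C] [Abelian C] [Linear k C]
  [MonoidalCategory C] [MonoidalPreadditive C] [MonoidalLinear k C] [BraidedCategory C]
  [RightRigidCategory C] [RibbonCategory C] {A : Type*} [CommGroup A] {G : Grading A C}
  {ι : Type}

/-- The product of the grades of a row of strands. -/
def strandsGrade (i : ι → A) : List ι → A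
  | [] => 1
  | j :: l => i j * strandsGrade i l

/-- Since `A` is commutative, a further strand on the left contributes the same object `λ` above and
below the crossing, which is what the cast in `Crossing.lamIso` needs. -/
lemma Crossing.strandsGrade_eq (i : ι → A) {l l' : List ι} (c : Crossing ι l l') :
    strandsGrade i l = strandsGrade i l' := by
  induction c with
  | pos a b l => exact mul_left_comm _ _ _
  | neg a b l => exact mul_left_comm _ _ _
  | cons a c ih => exact congrArg (i a * ·) ih

lemma Grading.strandsObj_mem {i : ι → A} {X : ι → C} (hX : ∀ j, G.comp (i j) (X j)) :
    ∀ l : List ι, G.comp (strandsGrade i l) (strandsObj X l)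
  | [] => G.unit_mem
  | j :: l => G.tensor_mem (hX j) (strandsObj_mem hX l)

variable (Z : RibbonZesting k G) (i : ι → A)

/-- The tensor product of the invertible objects that occur in the zested tensor product of a row
of strands of grades `i`. -/
def strandsLam : List ι → C
  | [] => 𝟙_ C
  | j :: l => strandsLam l ⊗ Z.lam (i j) (strandsGrade i l)

lemma strandsLam_mem : ∀ l : List ι, G.comp 1 (strandsLam Z i l)
  | [] => G.unit_mem
  | j :: l => mul_one (1 : A) ▸ G.tensor_mem (strandsLam_mem l) (Z.lam_mem (i j) (strandsGrade i l))

lemma strandsLam_invertible : ∀ l : List ι, ∃ M : C, Nonempty (strandsLam Z i l ⊗ M ≅ 𝟙_ C)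
  | [] => ⟨𝟙_ C, ⟨λ_ _⟩⟩
  | j :: l => by
    obtain ⟨M, ⟨e⟩⟩ := strandsLam_invertible l
    obtain ⟨N, -, ⟨e'⟩⟩ := Z.lam_invertible (i j) (strandsGrade i l)
    exact ⟨N ⊗ M, ⟨(α_ _ _ _ ≪≫ whiskerLeftIso _ ((α_ _ _ _).symm ≪≫ whiskerRightIso e' M ≪≫
      λ_ M)) ≪≫ e⟩⟩

/-- The action on the invertible objects of exchanging two strands, for an isomorphism
`λ(a,b) ≅ λ(b,a)`. -/
def lamExchange (a b c : A) (t : Z.lam a b ≅ Z.lam b a) :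
    Z.lam b c ⊗ Z.lam a (b * c) ≅ Z.lam a c ⊗ Z.lam b (a * c) :=
  (Z.assoc a b c).symm ≪≫ (t ⊗ᵢ lamCast Z.lam (mul_comm a b) rfl) ≪≫ Z.assoc b a c

/-- The action of a crossing on the tensor product of invertible objects. -/
def Crossing.lamIso : {l l' : List ι} → Crossing ι l l' → (strandsLam Z i l ≅ strandsLam Z i l')
  | _, _, .pos a b l => α_ _ _ _ ≪≫ whiskerLeftIso (strandsLam Z i l)
      (lamExchange Z (i a) (i b) (strandsGrade i l) (Z.t (i a) (i b))) ≪≫ (α_ _ _ _).symm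
  | _, _, .neg a b l => α_ _ _ _ ≪≫ whiskerLeftIso (strandsLam Z i l)
      (lamExchange Z (i a) (i b) (strandsGrade i l) (Z.t (i b) (i a)).symm) ≪≫ (α_ _ _ _).symm
  | _, _, .cons a c => c.lamIso ⊗ᵢ lamCast Z.lam rfl (c.strandsGrade_eq i)

/-- The action of a braid word on the tensor product of invertible objects. -/
def BraidWord.lamIso : {l l' : List ι} → BraidWord ι l l' → (strandsLam Z i l ≅ strandsLam Z i l')
  | _, _, .nil l => Iso.refl _
  | _, _, .cons c b => c.lamIso Z i ≪≫ b.lamIso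

variable {i} {X : ι → C} (hX : ∀ j, G.comp (i j) (X j))

/-- The colours of the strands as objects of the zested category. -/
abbrev zestedColours (j : ι) : Zested Z := ⟨i j, X j, hX j⟩

/-- The row of strands in `C`, tensored with the invertible objects, as an object of the zested
category. -/
def splitObj (l : List ι) : Zested Z where
  grade := strandsGrade i l
  obj := strandsObj X l ⊗ strandsLam Z i l
  mem := by simpa using G.tensor_mem (G.strandsObj_mem hX l) (strandsLam_mem Z i l)

/-- The reassociation splitting off the invertible objects for one more strand. -/
noncomputable def splitCons (j : ι) (l : List ι) :
    zestedColours Z hX j ⊗ splitObj Z hX l ≅ splitObj Z hX (j :: l) :=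
  Zested.mkIso (show (X j ⊗ strandsObj X l ⊗ strandsLam Z i l) ⊗ Z.lam (i j) (strandsGrade i l) ≅
      (X j ⊗ strandsObj X l) ⊗ strandsLam Z i l ⊗ Z.lam (i j) (strandsGrade i l) from
    whiskerRightIso (α_ _ _ _).symm _ ≪≫ α_ _ _ _)

/-- The zested tensor product of a row of strands is their tensor product in `C`, tensored with
invertible objects. -/
noncomputable def splitIso :
    (l : List ι) → (strandsObj (zestedColours Z hX) l ≅ splitObj Z hX l)
  | [] => Zested.mkIso (show 𝟙_ C ≅ 𝟙_ C ⊗ 𝟙_ C from (λ_ _).symm)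
  | j :: l => whiskerLeftIso (zestedColours Z hX j) (splitIso l) ≪≫ splitCons Z hX j l

/-- A morphism of rows of strands in `C` tensored with one of invertible objects. -/
def splitHom {l l' : List ι} (f : strandsObj X l ⟶ strandsObj X l')
    (g : strandsLam Z i l ⟶ strandsLam Z i l') : splitObj Z hX l ⟶ splitObj Z hX l' :=
  ⟨f ⊗ₘ g⟩

lemma splitHom_comp {l l' l'' : List ι} (f : strandsObj X l ⟶ strandsObj X l')
    (g : strandsLam Z i l ⟶ strandsLam Z i l') (f' : strandsObj X l' ⟶ strandsObj X l'')
    (g' : strandsLam Z i l' ⟶ strandsLam Z i l'') :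
    splitHom Z hX f g ≫ splitHom Z hX f' g' = splitHom Z hX (f ≫ f') (g ≫ g') :=
  Zested.hom_ext (tensorHom_comp_tensorHom _ _ _ _)

/-- Splitting a strand off on the left uses only associators of `C`, no braiding, so it is natural
in both factors of the row. -/
lemma whiskerLeft_splitHom (j : ι) {l l' : List ι} (f : strandsObj X l ⟶ strandsObj X l')
    (g : strandsLam Z i l ⟶ strandsLam Z i l') (h : strandsGrade i l = strandsGrade i l') :
    zestedColours Z hX j ◁ splitHom Z hX f g ≫ (splitCons Z hX j l').hom =
      (splitCons Z hX j l).hom ≫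
        splitHom Z hX (l := j :: l) (l' := j :: l') (X j ◁ f) (g ⊗ₘ (lamCast Z.lam (rfl : i j = i j) h).hom) := by
  have key : ∀ {x s s' m m' n n' : C} (f : s ⟶ s') (g : m ⟶ m') (r : n ⟶ n'),
      ((𝟙 x ⊗ₘ f ⊗ₘ g) ⊗ₘ r) ≫ (α_ x s' m').inv ▷ n' ≫ (α_ _ _ _).hom =
        ((α_ x s m).inv ▷ n ≫ (α_ _ _ _).hom) ≫ (x ◁ f ⊗ₘ g ⊗ₘ r) := by
    intros
    simp only [MonoidalCategory.tensorHom_def]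
    monoidal
  refine Zested.hom_ext (Eq.trans ?_ (key f g (lamCast Z.lam (rfl : i j = i j) h).hom))
  -- Zested whiskering acts on `λ` by `lamMap`, which for equal grades is the cast; in that form
  -- both sides unfold to the coherence statement `key` in `C`.
  rw [← lamMap_eq Z.lam (rfl : i j = i j) h]
  rfl

/-- After `asc_conj` has removed the half braidings, `c` acts only on the colours and `t`,
conjugated by the `λ_{a,b,c}`, only on the invertible objects; the rest is coherence. Keeping `c`
and `t` general treats positive and negative crossings at once. -/
lemma exchange_split (a b : ι) (l : List ι) (c : X a ⊗ X b ⟶ X b ⊗ X a)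
    (t : Z.lam (i a) (i b) ≅ Z.lam (i b) (i a))
    (B : zestedColours Z hX a ⊗ zestedColours Z hX b ⟶ zestedColours Z hX b ⊗ zestedColours Z hX a)
    (hB : B.hom = c ⊗ₘ t.hom) :
    ((α_ (zestedColours Z hX a) (zestedColours Z hX b) (splitObj Z hX l)).inv ≫
      B ▷ splitObj Z hX l ≫
      (α_ (zestedColours Z hX b) (zestedColours Z hX a) (splitObj Z hX l)).hom) ≫
        zestedColours Z hX b ◁ (splitCons Z hX a l).hom ≫ (splitCons Z hX b (a :: l)).hom =
      (zestedColours Z hX a ◁ (splitCons Z hX b l).hom ≫ (splitCons Z hX a (b :: l)).hom) ≫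
        splitHom Z hX (l := a :: b :: l) (l' := b :: a :: l)
          ((α_ _ _ _).inv ≫ c ▷ strandsObj X l ≫ (α_ _ _ _).hom)
          ((α_ _ _ _).hom ≫ strandsLam Z i l ◁
            (lamExchange Z (i a) (i b) (strandsGrade i l) t).hom ≫ (α_ _ _ _).inv) := by
  have h1 := asc_conj (X a) (X b) (X b) (X a) (strandsObj X l ⊗ strandsLam Z i l)
    (Z.assoc (i a) (i b) (strandsGrade i l)) (Z.assoc (i b) (i a) (strandsGrade i l)) c t.hom
    (lamCast Z.lam (mul_comm (i a) (i b)) (rfl : strandsGrade i l = strandsGrade i l)).hom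
  have key : ∀ {x y s m p q p' q' : C} (c : x ⊗ y ⟶ y ⊗ x) (n : p ⊗ q ⟶ p' ⊗ q'),
      (𝟙 _ ⊗≫ c ▷ ((s ⊗ m) ⊗ p ⊗ q) ⊗≫ (y ⊗ x ⊗ s ⊗ m) ◁ n ⊗≫ 𝟙 _) ≫
        ((𝟙 y ⊗ₘ ((α_ x s m).inv ▷ p' ≫ (α_ _ _ _).hom)) ⊗ₘ 𝟙 q') ≫
          (α_ y (x ⊗ s) (m ⊗ p')).inv ▷ q' ≫ (α_ _ _ _).hom =
      (((𝟙 x ⊗ₘ ((α_ y s m).inv ▷ p ≫ (α_ _ _ _).hom)) ⊗ₘ 𝟙 q) ≫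
          (α_ x (y ⊗ s) (m ⊗ p)).inv ▷ q ≫ (α_ _ _ _).hom) ≫
        (((α_ x y s).inv ≫ c ▷ s ≫ (α_ y x s).hom) ⊗ₘ
          ((α_ m p q).hom ≫ m ◁ n ≫ (α_ m p' q').inv)) := by
    intros
    simp only [MonoidalCategory.tensorHom_def]
    monoidal
  refine Zested.hom_ext (Eq.trans ?_ ((congrArg (· ≫ _) h1).trans (key c _)) |>.trans ?_)
  · rw [← lamMap_eq Z.lam (mul_comm (i a) (i b)) (rfl : strandsGrade i l = strandsGrade i l),
      ← lamMap_self Z.lam (i b) (i a * strandsGrade i l), ← hB,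
      ← tensorHom_id B.hom (strandsObj X l ⊗ strandsLam Z i l)]
    rfl
  · rw [← lamMap_self Z.lam (i a) (i b * strandsGrade i l)]
    rfl

lemma splitIso_cons_cons (a b : ι) (l : List ι) : (splitIso Z hX (a :: b :: l)).hom =
    zestedColours Z hX a ◁ zestedColours Z hX b ◁ (splitIso Z hX l).hom ≫
      zestedColours Z hX a ◁ (splitCons Z hX b l).hom ≫ (splitCons Z hX a (b :: l)).hom := by
  rw [← MonoidalCategory.whiskerLeft_comp_assoc]
  rfl

/-- Passes from a row whose tail has already been split to the genuine zested row, by naturality of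
the exchange in the tail. -/
lemma exchange_eq_of_split (a b : ι) (l : List ι)
    (B : zestedColours Z hX a ⊗ zestedColours Z hX b ⟶ zestedColours Z hX b ⊗ zestedColours Z hX a)
    (s : splitObj Z hX (a :: b :: l) ⟶ splitObj Z hX (b :: a :: l))
    (h : ((α_ (zestedColours Z hX a) (zestedColours Z hX b) (splitObj Z hX l)).inv ≫
        B ▷ splitObj Z hX l ≫
        (α_ (zestedColours Z hX b) (zestedColours Z hX a) (splitObj Z hX l)).hom) ≫
          zestedColours Z hX b ◁ (splitCons Z hX a l).hom ≫ (splitCons Z hX b (a :: l)).hom =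
      (zestedColours Z hX a ◁ (splitCons Z hX b l).hom ≫ (splitCons Z hX a (b :: l)).hom) ≫ s) :
    (α_ (zestedColours Z hX a) (zestedColours Z hX b) (strandsObj (zestedColours Z hX) l)).inv ≫
      B ▷ strandsObj (zestedColours Z hX) l ≫
      (α_ (zestedColours Z hX b) (zestedColours Z hX a) (strandsObj (zestedColours Z hX) l)).hom =
      (splitIso Z hX (a :: b :: l)).hom ≫ s ≫ (splitIso Z hX (b :: a :: l)).inv := by
  refine ((Iso.eq_comp_inv (splitIso Z hX (b :: a :: l))).2 ?_).trans (Category.assoc _ _ _)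
  refine (congrArg (_ ≫ ·) (splitIso_cons_cons Z hX b a l)).trans
    (Eq.trans ?_ (congrArg (· ≫ s) (splitIso_cons_cons Z hX a b l).symm))
  exact exchange_naturality _ B _ _ s h

/-- The heart of the proof: conjugated by the splittings, a zested crossing is the crossing of `C`
tensored with an isomorphism that knows only the grades. -/
lemma Crossing.eval_zested {l l' : List ι} (c : Crossing ι l l') :
    c.eval (zestedColours Z hX) = (splitIso Z hX l).hom ≫
      splitHom Z hX (c.eval X) (c.lamIso Z i).hom ≫ (splitIso Z hX l').inv := by
  induction c with
  | pos a b l =>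
    exact exchange_eq_of_split Z hX a b l _ _
      (exchange_split Z hX a b l (β_ (X a) (X b)).hom (Z.t (i a) (i b)) _ rfl)
  | neg a b l =>
    exact exchange_eq_of_split Z hX a b l _ _
      -- The inverse of the zested braiding of `X b` with `X a` involves `t(b,a)⁻¹`, which again
      -- goes from `λ(a,b)` to `λ(b,a)`.
      (exchange_split Z hX a b l (β_ (X b) (X a)).inv (Z.t (i b) (i a)).symm _ rfl)
  | @cons j l l' c ih =>
    rw [← Category.assoc, Iso.eq_comp_inv]
    have h := whiskerLeft_splitHom Z hX j (c.eval X) (c.lamIso Z i).hom (c.strandsGrade_eq i)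
    change zestedColours Z hX j ◁ c.eval (zestedColours Z hX) ≫
        zestedColours Z hX j ◁ (splitIso Z hX l').hom ≫ (splitCons Z hX j l').hom =
      (zestedColours Z hX j ◁ (splitIso Z hX l).hom ≫ (splitCons Z hX j l).hom) ≫ _
    rw [ih, Category.assoc]
    simp only [MonoidalCategory.whiskerLeft_comp, Category.assoc]
    rw [← MonoidalCategory.whiskerLeft_comp_assoc _ (splitIso Z hX l').inv, Iso.inv_hom_id,
      MonoidalCategory.whiskerLeft_id, Category.id_comp, h]
    rfl

lemma BraidWord.eval_zested {l l' : List ι} (b : BraidWord ι l l') :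
    b.eval (zestedColours Z hX) = (splitIso Z hX l).hom ≫
      splitHom Z hX (b.eval X) (b.lamIso Z i).hom ≫ (splitIso Z hX l').inv := by
  induction b with
  | nil l =>
    have : splitHom Z hX (𝟙 (strandsObj X l)) (𝟙 (strandsLam Z i l)) = 𝟙 _ := by
      ext
      simp [splitHom, splitObj]
    simp [BraidWord.eval, BraidWord.lamIso, this]
  | cons c b ih =>
    rw [BraidWord.eval, c.eval_zested Z hX, ih]
    simp [BraidWord.eval, BraidWord.lamIso, ← splitHom_comp]

end Split

/-! ### The zested trace and the resulting scalar -/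

section ZestedTrace

section Raw

variable {D : Type u} [Category.{v} D] [MonoidalCategory D] [BraidedCategory D]

/-- The braiding carries `X` past `b`, and the evaluation carries it back by the inverse braiding.
Once these cancel, the `X`-loop and the loop of `b`, `p`, `q` are unlinked and the closed diagram
factors. -/
lemma raw_trace {X Y b p q : D} [ExactPairing X Y] (η : 𝟙_ D ≅ b ⊗ p) (κ : b ⊗ q ≅ 𝟙_ D)
    (t : p ⟶ q) (F : X ⟶ X) :
    coevRaw X Y η ≫ ((F ⊗ₘ 𝟙 (Y ⊗ b)) ⊗ₘ 𝟙 p) ≫ ((β_ X (Y ⊗ b)).hom ⊗ₘ t) ≫ evRaw X Y κ =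
      (η_ X Y ≫ F ▷ Y ≫ (β_ X Y).hom ≫ ε_ X Y) ≫ η.hom ≫ b ◁ t ≫ κ.hom := by
  simp only [coevRaw, evRaw, BraidedCategory.braiding_tensor_right_hom,
    MonoidalCategory.tensorHom_def]
  calc
    _ = η_ X Y ⊗≫ (X ⊗ Y) ◁ η.hom ⊗≫ F ▷ (Y ⊗ b ⊗ p) ⊗≫ (β_ X Y).hom ▷ (b ⊗ p) ⊗≫
        Y ◁ ((β_ X b).hom ▷ p ≫ (b ⊗ X) ◁ t) ⊗≫ Y ◁ (β_ X b).inv ▷ q ⊗≫ ε_ X Y ▷ (b ⊗ q) ⊗≫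
        κ.hom := by monoidal
    _ = η_ X Y ⊗≫ (X ⊗ Y) ◁ η.hom ⊗≫ F ▷ (Y ⊗ b ⊗ p) ⊗≫ (β_ X Y).hom ▷ (b ⊗ p) ⊗≫
        (Y ⊗ X ⊗ b) ◁ t ⊗≫ Y ◁ ((β_ X b).hom ≫ (β_ X b).inv) ▷ q ⊗≫ ε_ X Y ▷ (b ⊗ q) ⊗≫
        κ.hom := by
      rw [← whisker_exchange]; monoidal
    _ = η_ X Y ⊗≫ ((X ⊗ Y) ◁ η.hom ≫ (F ▷ Y) ▷ (b ⊗ p)) ⊗≫ (β_ X Y).hom ▷ (b ⊗ p) ⊗≫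
        ((Y ⊗ X) ◁ (b ◁ t) ≫ ε_ X Y ▷ (b ⊗ q)) ⊗≫ κ.hom := by
      rw [Iso.hom_inv_id]; monoidal
    _ = η_ X Y ⊗≫ (F ▷ Y) ▷ 𝟙_ D ⊗≫ ((X ⊗ Y) ◁ η.hom ≫ ((β_ X Y).hom ≫ ε_ X Y) ▷ (b ⊗ p)) ⊗≫
        b ◁ t ⊗≫ κ.hom := by
      rw [whisker_exchange, whisker_exchange]; monoidal
    _ = _ := by
      rw [whisker_exchange]; monoidal

end Raw

variable {k : Type*} [Field k] {C : Type u} [Category.{v} C] [Abelian C] [Linear k C]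
  [MonoidalCategory C] [MonoidalPreadditive C] [MonoidalLinear k C] [BraidedCategory C]
  [RightRigidCategory C] [RibbonCategory C] {A : Type*} [CommGroup A] {G : Grading A C}

/-- The zested loop value of the invertible objects `λ(a, a⁻¹)` in the trace of an endomorphism of
an object of grade `a`. -/
noncomputable def lamLoop (Z : RibbonZesting k G) (a : A) : 𝟙_ C ≅ 𝟙_ C :=
  Zested.lamInvIso Z a ≪≫ whiskerLeftIso _ (Z.t a a⁻¹) ≪≫
    whiskerLeftIso _ (Zested.lamFlip Z a).symm ≪≫ (Zested.lamInvIso Z a).symm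

/-- `f` enters through the zested twist, and `lamLoop` is the second factor of `raw_trace` for the
zested dual. -/
lemma trace_hom {Z : RibbonZesting k G} {X : Zested Z} (F : X ⟶ X) :
    (trace F).hom = (Z.f X.grade : k) • (trace F.hom ≫ (lamLoop Z X.grade).hom) := by
  obtain ⟨a, X, hX⟩ := X
  have h := raw_trace (X := X) (Y := Xᘁ) (Zested.lamInvIso Z a)
    (whiskerLeftIso _ (Zested.lamFlip Z a).symm ≪≫ (Zested.lamInvIso Z a).symm) (Z.t a a⁻¹).hom
    (F.hom ≫ ((Z.f a : k) • (RibbonCategory.twist X).hom))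
  have h' : (Z.f a : k) • (trace F.hom ≫ (lamLoop Z a).hom) =
      (η_ X Xᘁ ≫ (F.hom ≫ ((Z.f a : k) • (RibbonCategory.twist X).hom)) ▷ Xᘁ ≫ (β_ X Xᘁ).hom ≫
        ε_ X Xᘁ) ≫ (lamLoop Z a).hom := by
    simp [trace]
  rw [← lamMap_self Z.lam a a⁻¹] at h
  exact h.trans h'.symm

lemma exists_invariant_scalar [IsAlgClosed k] [IsFusionCategory k C] (Z : RibbonZesting k G)
    {n : ℕ} (L : FramedLink n) (i : Fin n → A) :
    ∃ s : kˣ, ∀ (X : Fin n → C) (hX : ∀ j, G.comp (i j) (X j)),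
      (L.invariant (zestedColours Z hX)).hom = (s : k) • L.invariant X := by
  obtain ⟨M, ⟨e⟩⟩ := strandsLam_invertible Z i L.strands
  obtain ⟨d, hd⟩ := exists_trace_tensor (k := k) e (L.braid.lamIso Z i).hom
  obtain ⟨w, hw⟩ := exists_unit_smul_of_isIso (k := k) (lamLoop Z (strandsGrade i L.strands)).hom
  -- The factors come from the zested twist on the whole row, from the loop of `λ(a,a⁻¹)` at its
  -- total grade `a`, and from the closure of the braid's action on `strandsLam`.
  refine ⟨Z.f (strandsGrade i L.strands) * w * d, fun X hX => ?_⟩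
  rw [FramedLink.invariant, L.braid.eval_zested Z hX, trace_conj, trace_hom]
  change _ • (trace (L.braid.eval X ⊗ₘ (L.braid.lamIso Z i).hom) ≫
    (lamLoop Z (strandsGrade i L.strands)).hom) = _
  rw [hd, hw, FramedLink.invariant]
  simp only [Linear.comp_smul, Category.comp_id, smul_smul, Units.val_mul]
  rw [mul_assoc]
  rfl

end ZestedTrace

end Zesting

theorem theorem5p1 {k : Type*} [Field k] [IsAlgClosed k] [CharZero k]
    {C : Type u} [Category.{v} C] [Abelian C] [Linear k C] [MonoidalCategory C]
    [MonoidalPreadditive C] [MonoidalLinear k C] [BraidedCategory C] [RightRigidCategory C]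
    [Zesting.RibbonCategory C] [Zesting.IsFusionCategory k C]
    {A : Type*} [CommGroup A] (G : Zesting.Grading A C) {n : ℕ} (L : Zesting.FramedLink n) :
    ∃ h : Zesting.RibbonZesting k G → (Fin n → A) → kˣ,
      ∀ (Z : Zesting.RibbonZesting k G) (i : Fin n → A) (X : Fin n → C)
        (hX : ∀ j, G.comp (i j) (X j)), (∀ j, Simple (X j)) →
        (L.invariant (fun j => (⟨i j, X j, hX j⟩ : Zesting.Zested Z))).hom =
          (h Z i : k) • L.invariant X := by
  -- The scalar is chosen from `Z` and `i` alone, before any colours are given.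
  choose h hh using fun (Z : Zesting.RibbonZesting k G) (i : Fin n → A) =>
    Zesting.exists_invariant_scalar Z L i
  exact ⟨h, fun Z i X hX _ => hh Z i X hX⟩
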